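/- Let $\mathcal X$ be a finite set, let $1 \le n_0 \le n$ be integers, and let $k_{n_0}, \dots, k_n \ge 0$ be integers, fixed in advance, with $k = \sum_{\tau=n_0}^{n} k_\tau \ge 1$. A statistical query is a function $q : \mathcal X \to [0,1]$; for $x \in \mathcal X^t$ put $q(x) = \frac1t\sum_{i=1}^t q(x_i)$, and for a probability distribution $\mathcal P$ on $\mathcal X$ put $q(\mathcal P^t) = \mathbb E_{X \sim \mathcal P^t}[q(X)]$. For $\sigma > 0$ the clipped Gaussian mechanism $\mathsf M_\sigma$ answers a query $q$ on a data set $x$ by $\max(0, \min(q(x) + z, 1))$ with fresh noise $z \sim \mathcal N(0, \sigma^2)$. A growing data set $X = (X_1, \dots, X_n) \sim \mathcal P^n$ is analysed in rounds $t = n_0, \dots, n$. In round $t$ a randomized analyst submits $k_t$ statistical queries one after another, each drawn from a distribution that depends only on all previous queries and responses (the transcript so far), and each is answered by $\mathsf M_\sigma$ on the snapshot $(X_1, \dots, X_t)$ before the next one is chosen. For $\alpha \ge 0$ and $\beta' \in (0,1)$, the mechanism is called $(\alpha, \beta')$-distributionally accurate if for every analyst and every $\mathcal P$, with probability at least $1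 - \beta'$ over data set and transcript, $|R - Q(\mathcal P^t)| \le \alpha$ holds simultaneously for all rounds $t$ and all query-response pairs $(Q, R)$ of round $t$. For $\sigma > 0$, $\epsilon \ge 0$ and $t \in \{1, \dots, n\}$ let $$\vec\rho(t) = \sum_{\tau = n_0}^{n} \frac{k_\tau \mathbf 1\{t \le \tau\}}{2 \sigma^2 \tau^2}, \qquad \psi(\gamma, \rho, \epsilon) = \frac{e^{(\gamma - 1)(\gamma\rho - \epsilon)} (1 - \gamma^{-1})^{\gamma}}{\gamma - 1}, \qquad \vec\delta(t) = \psi(\gamma^\star, \vec\rho(t), \epsilon),$$ where $\gamma^\star$ is the unique minimizer of $\gamma \mapsto \psi(\gamma, \max_{1 \le s \le n} \vec\rho(s), \epsilon)$ over $(1, \infty)$. Let $\Theta = \{(\sigma, \beta, \epsilon) \in \mathbb R^3 : \sigma > 0,\ 0 < \beta < 1,\ \epsilon \ge 0\}$, fix $\beta' \in (0,1)$, and for $(\sigma,\beta,\epsilon) \in \Theta$ let $$\lambda(\sigma, \beta, \epsilon) = \sqrt 2\, \sigma\, \mathrm{erfc}^{-1}\!\left(\frac{\beta}{k}\right) + e^{\epsilon}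 - 1 + \frac{\beta}{\beta'} + \frac{2 \sum_{\tau=1}^{n} \vec\delta(\tau)}{n_0 \beta'} + \frac{2}{\beta'} \sqrt{\frac{2 \beta \sum_{\tau=1}^{n} \vec\delta(\tau)}{n_0}}, \qquad \alpha' = \inf_{\Theta} \lambda .$$ Then: 1. for every $(\sigma, \beta, \epsilon) \in \Theta$, the mechanism $\mathsf M_\sigma$ is $(\lambda(\sigma, \beta, \epsilon), \beta')$-distributionally accurate; 2. if $\alpha' < 1$, the infimum is attained, so that $\alpha' = \min_{\Theta} \lambda$; 3. for a suitable $\sigma > 0$ (by 1, the $\sigma$-component of any minimizer of $\lambda$, if there is one), $\mathsf M_\sigma$ is $(\alpha', \beta')$-distributionally accurate. -/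

import Mathlib

open MeasureTheory ProbabilityTheory
open scoped ENNReal NNReal

noncomputable section

namespace GrowingADA

/-! ### Statistical queries and snapshots -/

/-- A statistical query on the domain `X` is given by a function `X → [0, 1]`. -/
abbrev StatQuery (X : Type*) := X → Set.Icc (0 : ℝ) 1

/-- The value of a statistical query on a data set of size `m`: the empirical mean. -/
def evalOn {X : Type*} {m : ℕ} (q : StatQuery X) (y : Fin m → X) : ℝ :=
  (∑ i, (q (y i) : ℝ)) / m

/-- The value of the query on the distribution `P ^ t`, the law of `t` i.i.d. data points. -/
def popValue {X : Type*} [MeasurableSpace X] (q : StatQuery X) (P : Measure X) (t : ℕ) : ℝ :=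
  ∫ y, evalOn q y ∂(Measure.pi fun _ : Fin t => P)

/-- The first `t` data points of a growing data set with horizon `n` (all of it if `n ≤ t`). -/
def snapshot {X : Type*} {n : ℕ} (x : Fin n → X) (t : ℕ) : Fin (min t n) → X :=
  fun i => x (Fin.castLE (min_le_right t n) i)

/-! ### Mechanism, analyst and their interaction -/

/-- A mechanism answers a query at random, using a snapshot `y` of any size `m`. The size of the
snapshot is also the index of the current round. -/
structure Mechanism (X : Type*) where
  answer : ∀ m : ℕ, (Fin m → X) → Kernel (StatQuery X) ℝ
  markov : ∀ m y, IsMarkovKernel (answer m y)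

/-- A randomized analyst chooses the next query from the transcript of the `i` previous
query-response pairs. -/
structure Analyst (X : Type*) where
  query : ∀ i : ℕ, Kernel (Fin i → StatQuery X × ℝ) (StatQuery X)
  markov : ∀ i, IsMarkovKernel (query i)

/-- If `kk τ` queries are asked in each round `τ ≥ n₀`, then this is the round in which the
query number `i` (counted from `0`) is asked. -/
def roundOf (n₀ : ℕ) (kk : ℕ → ℕ) (i : ℕ) : ℕ :=
  sInf {t | i < ∑ τ ∈ Finset.Icc n₀ t, kk τ}

/-- The law of the first `m` query-response pairs when the analyst `A` interacts with `M` on the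
growing data set `x`: in each step the analyst picks `Q` from the transcript so far, the
mechanism draws the response `R` from `Q` and the snapshot of the current round, and `(Q, R)` is
appended to the transcript. -/
def interact {X : Type*} {n : ℕ} (M : Mechanism X) (A : Analyst X) (n₀ : ℕ) (kk : ℕ → ℕ)
    (x : Fin n → X) : (m : ℕ) → Measure (Fin m → StatQuery X × ℝ)
  | 0 => Measure.dirac Fin.elim0
  | m + 1 =>
    (interact M A n₀ kk x m ⊗ₘ
      (A.query m ⊗ₖ Kernel.prodMkLeft (Fin m → StatQuery X × ℝ)
        (M.answer _ (snapshot x (roundOf n₀ kk m))))).map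
      (fun p => Fin.snoc (α := fun _ => StatQuery X × ℝ) p.1 p.2)

instance isProbabilityMeasure_interact {X : Type*} {n : ℕ} (M : Mechanism X) (A : Analyst X)
    (n₀ : ℕ) (kk : ℕ → ℕ) (x : Fin n → X) (m : ℕ) :
    IsProbabilityMeasure (interact M A n₀ kk x m) := by
  induction m with
  | zero => unfold interact; infer_instance
  | succ m ih =>
    unfold interact
    have := A.markov m
    have := M.markov _ (snapshot x (roundOf n₀ kk m))
    refine Measure.isProbabilityMeasure_map (Measurable.aemeasurable ?_)
    refine measurable_pi_lambda _ fun i => ?_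
    refine Fin.lastCases ?_ (fun j => ?_) i
    · simpa using measurable_snd
    · simp only [Fin.snoc_castSucc]
      fun_prop

/-- The total number of queries, all of which are asked in the rounds `n₀, …, n`. -/
def totalQueries (n₀ n : ℕ) (kk : ℕ → ℕ) : ℕ := ∑ τ ∈ Finset.Icc n₀ n, kk τ

/-- The joint law of the data set, drawn from `P ^ n`, and of the transcript. -/
def jointLaw {X : Type*} [Finite X] [MeasurableSpace X] [MeasurableSingletonClass X]
    (M : Mechanism X) (A : Analyst X) (n₀ n : ℕ) (kk : ℕ → ℕ) (P : Measure X) :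
    Measure ((Fin n → X) × (Fin (totalQueries n₀ n kk) → StatQuery X × ℝ)) :=
  (Measure.pi fun _ : Fin n => P) ⊗ₘ
    Kernel.ofFunOfCountable fun x => interact M A n₀ kk x (totalQueries n₀ n kk)

/-- `({α t}, β)`-distributional accuracy, when `kk τ` queries are asked in round `τ`: for every
analyst and every data distribution, with probability at least `1 - β`, all responses `R` to
queries `Q` of a round `t` satisfy `|R - Q(P ^ t)| ≤ α t`, jointly for all rounds. -/
def DistAccurate {X : Type*} [Finite X] [MeasurableSpace X] [MeasurableSingletonClass X]
    (M : Mechanism X) (n₀ n : ℕ) (kk : ℕ → ℕ) (α : ℕ → ℝ) (β : ℝ) : Prop :=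
  ∀ (A : Analyst X) (P : Measure X), IsProbabilityMeasure P →
    1 - β ≤ (jointLaw M A n₀ n kk P).real
      {p | ∀ t ∈ Finset.Icc n₀ n, ∀ i : Fin (totalQueries n₀ n kk), roundOf n₀ kk i = t →
        |(p.2 i).2 - popValue (p.2 i).1 P t| ≤ α t}

/-! ### The clipped Gaussian mechanism -/

/-- Clamping to `[0, 1]`. -/
def clamp (r : ℝ) : ℝ := max 0 (min r 1)

/-- The answer `clamp (q(y) + z)` with `z ∼ N(0, s ^ 2)`, as a kernel in the query `q`. -/
def clippedGaussianKernel {X : Type*} (s : ℝ) {m : ℕ} (y : Fin m → X) :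
    Kernel (StatQuery X) ℝ :=
  (Kernel.id ×ₖ Kernel.const (StatQuery X) (gaussianReal 0 (s ^ 2).toNNReal)).map
    (fun p => clamp (evalOn p.1 y + p.2))

theorem measurable_clippedGaussian {X : Type*} {m : ℕ} (y : Fin m → X) :
    Measurable (fun p : StatQuery X × ℝ => clamp (evalOn p.1 y + p.2)) := by
  unfold clamp evalOn
  fun_prop

/-- The clipped Gaussian mechanism with standard deviation `σ t` in round `t`. -/
def clippedGaussian (X : Type*) (σ : ℕ → ℝ) : Mechanism X where
  answer m y := clippedGaussianKernel (σ m) y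
  markov _ y := Kernel.IsMarkovKernel.map _ (measurable_clippedGaussian y)

/-! ### The error bound -/

/-- The complementary error function. -/
def erfc (x : ℝ) : ℝ := 2 / √Real.pi * ∫ t in Set.Ioi x, Real.exp (-t ^ 2)

/-- The inverse of the complementary error function, which maps `ℝ` onto `(0, 2)`. -/
def erfcInv : ℝ → ℝ := Function.invFun erfc

/-- The non-uniform zCDP parameter of the data point `t`. -/
def rho (n₀ n : ℕ) (kk : ℕ → ℕ) (σ : ℕ → ℝ) (t : ℕ) : ℝ :=
  ∑ τ ∈ Finset.Icc n₀ n, kk τ * (if t ≤ τ then 1 else 0) / (2 * σ τ ^ 2 * (τ : ℝ) ^ 2)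

def psi (γ ρ ε : ℝ) : ℝ :=
  Real.exp ((γ - 1) * (γ * ρ - ε)) * (1 - γ⁻¹) ^ γ / (γ - 1)

/-- The minimizer of `psi · ρ ε` over `(1, ∞)`, which exists and is unique if `ρ > 0`. -/
def gammaStar (ρ ε : ℝ) : ℝ :=
  Classical.epsilon fun γ => γ ∈ Set.Ioi (1 : ℝ) ∧ IsMinOn (fun g => psi g ρ ε) (Set.Ioi 1) γ

/-- The non-uniform parameter `δ(t)` of approximate differential privacy. -/
def delta (n₀ n : ℕ) (kk : ℕ → ℕ) (σ : ℕ → ℝ) (ε : ℝ) (t : ℕ) : ℝ :=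
  psi (gammaStar (sSup (rho n₀ n kk σ '' Set.Icc 1 n)) ε) (rho n₀ n kk σ t) ε

/-- The parameters `(σ, β, ε)`. -/
def Theta : Set (ℝ × ℝ × ℝ) := {p | 0 < p.1 ∧ (0 < p.2.1 ∧ p.2.1 < 1) ∧ 0 ≤ p.2.2}

/-- The error bound `λ(σ, β, ε)`, for the confidence parameter `β'`. -/
def errBound (n₀ n : ℕ) (kk : ℕ → ℕ) (β' : ℝ) : ℝ × ℝ × ℝ → ℝ := fun (σ, β, ε) =>
  √2 * σ * erfcInv (β / totalQueries n₀ n kk) + Real.exp ε - 1 + β / β'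
    + 2 * (∑ τ ∈ Finset.Icc 1 n, delta n₀ n kk (fun _ => σ) ε τ) / (n₀ * β')
    + 2 / β' * √(2 * β * (∑ τ ∈ Finset.Icc 1 n, delta n₀ n kk (fun _ => σ) ε τ) / n₀)

end GrowingADA

end

/-! A clipped Gaussian answer to a query on a snapshot is a post-processing of the Gaussian
mechanism, whose Rényi divergence is explicit. Adaptive composition multiplies the Hölder-type
inequalities behind these divergences, and turning the result into approximate differential privacy
at a fixed order `γ` gives the parameter `psi γ (rho t) ε` for the `t`-th data point.

Privacy in turn controls overfitting. Among all queries, select one whose answer is inaccurate for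
the population, if there is one; resampling one data point at a time shows that its expected excess
error on the sample is small, and Markov's inequality makes this a statement about probabilities.
With the Gaussian tail bound for the noise, this proves accuracy with an error that `errBound`
dominates.

If `errBound` is below `1`, the parameters are confined to a compact box on which it is continuous,
so an infimum below `1` is attained; an error of at least `1` is trivial for answers in `[0, 1]`. -/

noncomputable section

namespace GrowingADA

open Filter Topology

/-! ### Hölder domination -/

section HolderDom

variable {Ω Ω' : Type*} [MeasurableSpace Ω] [MeasurableSpace Ω'] {r γ : ℝ} {c d : ℝ≥0∞}
  {μ ν : Measure Ω}

/-- `μ` is dominated by `ν` in the dual of `L ^ r`, with constant `c`. If `γ` is the conjugate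
exponent of `r`, this is the dual form of the bound `γ / (γ - 1) * log c` on the Rényi divergence
of order `γ` of `μ` from `ν`; unlike the latter it needs no density to be stated. -/
def HolderDom (r : ℝ) (c : ℝ≥0∞) (μ ν : Measure Ω) : Prop :=
  ∀ f : Ω → ℝ≥0∞, Measurable f → ∫⁻ ω, f ω ∂μ ≤ c * (∫⁻ ω, f ω ^ r ∂ν) ^ (1 / r)

theorem holderDom_withDensity (h : γ.HolderConjugate r) (ν : Measure Ω) {g : Ω → ℝ≥0∞}
    (hg : Measurable g) :
    HolderDom r ((∫⁻ ω, g ω ^ γ ∂ν) ^ (1 / γ)) (ν.withDensity g) ν := by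
  intro f hf
  rw [lintegral_withDensity_eq_lintegral_mul _ hg hf]
  exact ENNReal.lintegral_mul_le_Lp_mul_Lq ν h hg.aemeasurable hf.aemeasurable

theorem HolderDom.refl (h : γ.HolderConjugate r) (μ : Measure Ω) [IsProbabilityMeasure μ] :
    HolderDom r 1 μ μ := by
  simpa using holderDom_withDensity h μ measurable_one

theorem HolderDom.mono (hcd : c ≤ d) (h : HolderDom r c μ ν) : HolderDom r d μ ν :=
  fun f hf => (h f hf).trans (by gcongr)

theorem HolderDom.map (h : HolderDom r c μ ν) {g : Ω → Ω'} (hg : Measurable g) :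
    HolderDom r c (μ.map g) (ν.map g) := by
  intro f hf
  rw [lintegral_map hf hg, lintegral_map (hf.pow_const r) hg]
  exact h _ (hf.comp hg)

theorem HolderDom.compProd (hr : 0 < r) [SFinite μ] [SFinite ν] {κ η : Kernel Ω Ω'}
    [IsSFiniteKernel κ] [IsSFiniteKernel η] (h : HolderDom r c μ ν)
    (h' : ∀ ω, HolderDom r d (κ ω) (η ω)) : HolderDom r (c * d) (μ ⊗ₘ κ) (ν ⊗ₘ η) := by
  intro f hf
  rw [Measure.lintegral_compProd hf, Measure.lintegral_compProd (hf.pow_const r)]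
  have hm : Measurable fun ω => ∫⁻ ω', f (ω, ω') ^ r ∂η ω :=
    Measurable.lintegral_kernel_prod_right (f := fun ω ω' => f (ω, ω') ^ r) (hf.pow_const r)
  calc ∫⁻ ω, ∫⁻ ω', f (ω, ω') ∂κ ω ∂μ
      ≤ ∫⁻ ω, d * (∫⁻ ω', f (ω, ω') ^ r ∂η ω) ^ (1 / r) ∂μ :=
        lintegral_mono fun ω => h' ω _ (hf.comp measurable_prodMk_left)
    _ = d * ∫⁻ ω, (∫⁻ ω', f (ω, ω') ^ r ∂η ω) ^ (1 / r) ∂μ :=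
        lintegral_const_mul _ (hm.pow_const _)
    _ ≤ d * (c * (∫⁻ ω, ((∫⁻ ω', f (ω, ω') ^ r ∂η ω) ^ (1 / r)) ^ r ∂ν) ^ (1 / r)) := by
        gcongr
        exact h _ (hm.pow_const _)
    _ = c * d * (∫⁻ ω, ∫⁻ ω', f (ω, ω') ^ r ∂η ω ∂ν) ^ (1 / r) := by
        simp_rw [← ENNReal.rpow_mul, one_div_mul_cancel hr.ne', ENNReal.rpow_one]
        ring

theorem gaussianReal_eq_withDensity (a b : ℝ) {v : ℝ≥0} (hv : v ≠ 0) :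
    gaussianReal a v = (gaussianReal b v).withDensity
      fun z => ENNReal.ofReal (Real.exp ((a - b) * (2 * z - a - b) / (2 * v))) := by
  have hv' : (v : ℝ) ≠ 0 := mod_cast hv
  rw [gaussianReal_of_var_ne_zero _ hv, gaussianReal_of_var_ne_zero _ hv,
    ← withDensity_mul _ (measurable_gaussianPDF _ _) (by fun_prop)]
  congr 1 with z
  rw [Pi.mul_apply, gaussianPDF, gaussianPDF, ← ENNReal.ofReal_mul (gaussianPDFReal_nonneg _ _ _),
    gaussianPDFReal, gaussianPDFReal, mul_assoc _ _ (Real.exp _), ← Real.exp_add]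
  congr 3
  field_simp
  ring

theorem lintegral_exp_mul_gaussianReal (a b γ : ℝ) {v : ℝ≥0} (hv : v ≠ 0) :
    ∫⁻ z, ENNReal.ofReal (Real.exp ((a - b) * (2 * z - a - b) / (2 * v))) ^ γ ∂gaussianReal b v
      = ENNReal.ofReal (Real.exp (γ * (γ - 1) * ((a - b) ^ 2 / (2 * v)))) := by
  have hv' : (v : ℝ) ≠ 0 := mod_cast hv
  -- the `γ`-th power of the density of `N(a, v)` is a multiple of that of `N(b + γ (a - b), v)`
  have hpow : ∀ z, ENNReal.ofReal (Real.exp ((a - b) * (2 * z - a - b) / (2 * v))) ^ γ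
      = ENNReal.ofReal (Real.exp (γ * (γ - 1) * ((a - b) ^ 2 / (2 * v))))
        * ENNReal.ofReal (Real.exp ((b + γ * (a - b) - b) * (2 * z - (b + γ * (a - b)) - b)
          / (2 * v))) := fun z => by
    rw [ENNReal.ofReal_rpow_of_pos (Real.exp_pos _), ← Real.exp_mul,
      ← ENNReal.ofReal_mul (Real.exp_pos _).le, ← Real.exp_add]
    congr 2
    field_simp
    ring
  have hmass := congrArg (fun μ => μ Set.univ)
    (gaussianReal_eq_withDensity (b + γ * (a - b)) b hv)
  simp only [measure_univ, withDensity_apply _ MeasurableSet.univ, Measure.restrict_univ] at hmass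
  simp_rw [hpow]
  rw [lintegral_const_mul _ (by fun_prop), ← hmass, mul_one]

theorem holderDom_gaussianReal (h : γ.HolderConjugate r) (a b : ℝ) {v : ℝ≥0} (hv : v ≠ 0) :
    HolderDom r (ENNReal.ofReal (Real.exp ((γ - 1) * ((a - b) ^ 2 / (2 * v)))))
      (gaussianReal a v) (gaussianReal b v) := by
  have hγ := h.pos
  rw [gaussianReal_eq_withDensity a b hv]
  convert holderDom_withDensity h (gaussianReal b v) _ using 1
  · rw [lintegral_exp_mul_gaussianReal a b γ hv, ENNReal.ofReal_rpow_of_pos (Real.exp_pos _),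
      ← Real.exp_mul]
    congr 2
    field_simp
  · fun_prop

end HolderDom

/-! ### From Hölder domination to approximate differential privacy -/

section ApproxDP

variable {γ ρ ε : ℝ}

theorem one_sub_inv_pos (hγ : 1 < γ) : 0 < 1 - γ⁻¹ := sub_pos.2 (inv_lt_one_of_one_lt₀ hγ)

theorem psi_pos (hγ : 1 < γ) (ρ ε : ℝ) : 0 < psi γ ρ ε :=
  div_pos (mul_pos (Real.exp_pos _)
    (Real.rpow_pos_of_pos (one_sub_inv_pos hγ) _)) (by linarith)

theorem mul_psi (hγ : 1 < γ) (ρ ε : ℝ) :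
    γ * psi γ ρ ε = Real.exp ((γ - 1) * (γ * ρ - ε)) * (1 - γ⁻¹) ^ (γ - 1) := by
  have hw : 0 < 1 - γ⁻¹ := one_sub_inv_pos hγ
  have hγ0 : γ ≠ 0 := by linarith
  have hγ1 : γ - 1 ≠ 0 := by linarith
  have hw' : 1 - γ⁻¹ = (γ - 1) / γ := by field_simp
  rw [psi, Real.rpow_sub hw, Real.rpow_one, hw']
  field_simp

theorem exp_mul_rpow_le_psi {v : ℝ} (hγ : 1 < γ) (hv : 0 ≤ v) (ρ ε : ℝ) :
    Real.exp ((γ - 1) * ρ) * v ^ (1 - γ⁻¹) ≤ Real.exp ε * v + psi γ ρ ε := by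
  have hγ0 : 0 < γ := by linarith
  have hw : 0 < 1 - γ⁻¹ := one_sub_inv_pos hγ
  have hexp : (γ - 1) * γ⁻¹ = 1 - γ⁻¹ := by field_simp
  have hpow : (γ * psi γ ρ ε) ^ γ⁻¹
      = Real.exp ((1 - γ⁻¹) * (γ * ρ - ε)) * (1 - γ⁻¹) ^ (1 - γ⁻¹) := by
    rw [mul_psi hγ, Real.mul_rpow (Real.exp_pos _).le (by positivity), ← Real.exp_mul,
      ← Real.rpow_mul hw.le, hexp, mul_right_comm, hexp]
  have hne : (1 - γ⁻¹) ^ (1 - γ⁻¹) ≠ 0 := (Real.rpow_pos_of_pos hw _).ne'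
  calc Real.exp ((γ - 1) * ρ) * v ^ (1 - γ⁻¹)
      = Real.exp ((1 - γ⁻¹) * (γ * ρ - ε)) * Real.exp (ε * (1 - γ⁻¹)) * v ^ (1 - γ⁻¹) := by
        rw [← Real.exp_add]
        congr 2
        field_simp
        ring
    _ = (γ * psi γ ρ ε) ^ γ⁻¹ * (Real.exp ε * v / (1 - γ⁻¹)) ^ (1 - γ⁻¹) := by
        rw [hpow, Real.div_rpow (by positivity) hw.le, Real.mul_rpow (Real.exp_pos _).le hv,
          ← Real.exp_mul]
        generalize (1 - γ⁻¹) ^ (1 - γ⁻¹) = u at hne ⊢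
        field_simp
    _ ≤ γ⁻¹ * (γ * psi γ ρ ε) + (1 - γ⁻¹) * (Real.exp ε * v / (1 - γ⁻¹)) :=
        Real.geom_mean_le_arith_mean2_weighted (by positivity) hw.le
          (mul_pos hγ0 (psi_pos hγ ρ ε)).le (by positivity) (by ring)
    _ = Real.exp ε * v + psi γ ρ ε := by
        rw [inv_mul_cancel_left₀ hγ0.ne', mul_div_cancel₀ _ hw.ne', add_comm]

theorem one_sub_exp_le_psi (hγ : 1 < γ) (hρ : 0 ≤ ρ) (ε : ℝ) :
    1 - Real.exp (ε - ρ) ≤ psi γ ρ ε := by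
  have : 0 < γ := by linarith
  have hexp : 0 ≤ (γ - 1) * ρ + -ρ * (1 - γ⁻¹) := by
    have : (γ - 1) * ρ + -ρ * (1 - γ⁻¹) = ρ * (γ - 1) ^ 2 / γ := by
      field_simp
      ring
    rw [this]
    positivity
  have hyoung := exp_mul_rpow_le_psi hγ (Real.exp_pos (-ρ)).le ρ ε
  rw [← Real.exp_mul, ← Real.exp_add, ← Real.exp_add, ← sub_eq_add_neg] at hyoung
  linarith [Real.one_le_exp hexp]

variable {Ω : Type*} [MeasurableSpace Ω] {μ ν : Measure Ω} {r : ℝ} {f : Ω → ℝ}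

theorem HolderDom.integral_le_mul_rpow [IsFiniteMeasure ν] {C : ℝ} (hC : 0 ≤ C) (hr : 1 ≤ r)
    (h : HolderDom r (ENNReal.ofReal C) μ ν) (hf : Measurable f)
    (hf01 : ∀ ω, f ω ∈ Set.Icc (0 : ℝ) 1) :
    ∫ ω, f ω ∂μ ≤ C * (∫ ω, f ω ∂ν) ^ (1 / r) := by
  have hpos : 0 ≤ ∫ ω, f ω ∂ν := integral_nonneg fun ω => (hf01 ω).1
  rw [integral_eq_lintegral_of_nonneg_ae (.of_forall fun ω => (hf01 ω).1) hf.aestronglyMeasurable]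
  refine ENNReal.toReal_le_of_le_ofReal (by positivity) ((h _ hf.ennreal_ofReal).trans ?_)
  rw [ENNReal.ofReal_mul hC, ← ENNReal.ofReal_rpow_of_nonneg hpos (by positivity),
    ofReal_integral_eq_lintegral_ofReal
      (.of_mem_Icc 0 1 hf.aemeasurable (.of_forall hf01)) (.of_forall fun ω => (hf01 ω).1)]
  gcongr with ω
  rw [ENNReal.ofReal_rpow_of_nonneg (hf01 ω).1 (by linarith)]
  exact ENNReal.ofReal_le_ofReal (Real.rpow_le_self_of_le_one (hf01 ω).1 (hf01 ω).2 hr)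

theorem HolderDom.integral_le_add_psi [IsFiniteMeasure ν] (hγ : γ.HolderConjugate r)
    (h : HolderDom r (ENNReal.ofReal (Real.exp ((γ - 1) * ρ))) μ ν) (hf : Measurable f)
    (hf01 : ∀ ω, f ω ∈ Set.Icc (0 : ℝ) 1) (ε : ℝ) :
    ∫ ω, f ω ∂μ ≤ Real.exp ε * ∫ ω, f ω ∂ν + psi γ ρ ε := by
  have hexp : 1 / r = 1 - γ⁻¹ := by
    rw [one_div]
    linarith [hγ.inv_add_inv_eq_one]
  have hdom := h.integral_le_mul_rpow (Real.exp_pos _).le hγ.symm.lt.le hf hf01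
  rw [hexp] at hdom
  exact hdom.trans (exp_mul_rpow_le_psi hγ.lt (integral_nonneg fun ω => (hf01 ω).1) ρ ε)

end ApproxDP

/-! ### Privacy prevents overfitting to i.i.d. data -/

theorem integral_mem_Icc {Ω : Type*} [MeasurableSpace Ω] {μ : Measure Ω} [IsProbabilityMeasure μ]
    {f : Ω → ℝ} (hf : AEMeasurable f μ) {a b : ℝ} (h : ∀ᵐ ω ∂μ, f ω ∈ Set.Icc a b) :
    ∫ ω, f ω ∂μ ∈ Set.Icc a b :=
  (convex_Icc a b).integral_mem isClosed_Icc h (.of_mem_Icc a b hf h)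

theorem measurePreserving_update {ι : Type*} [Fintype ι] [DecidableEq ι] {α : ι → Type*}
    [∀ i, MeasurableSpace (α i)] (P : ∀ i, Measure (α i)) [∀ i, IsProbabilityMeasure (P i)]
    (j : ι) :
    MeasurePreserving (fun u : (∀ i, α i) × α j => Function.update u.1 j u.2)
      ((Measure.pi P).prod (P j)) (Measure.pi P) := by
  have hmeas : Measurable fun u : (∀ i, α i) × α j => Function.update u.1 j u.2 :=
    measurable_update'
  refine ⟨hmeas, (Measure.pi_eq fun s hs => ?_).symm⟩
  have hpre : (fun u : (∀ i, α i) × α j => Function.update u.1 j u.2) ⁻¹' Set.univ.pi s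
      = (Set.univ.pi (Function.update s j Set.univ)) ×ˢ s j := by
    ext u
    simp only [Set.mem_preimage, Set.mem_univ_pi, Set.mem_prod]
    refine ⟨fun h => ⟨fun i => ?_, by simpa using h j⟩, fun h i => ?_⟩
    · obtain rfl | hij := eq_or_ne i j
      · simp
      · simpa [hij] using h i
    · obtain rfl | hij := eq_or_ne i j
      · simpa using h.2
      · simpa [hij] using h.1 i
  rw [Measure.map_apply hmeas (.univ_pi hs), hpre, Measure.prod_prod, Measure.pi_pi,
    ← Finset.mul_prod_erase _ _ (Finset.mem_univ j), Function.update_self, measure_univ, one_mul,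
    mul_comm, ← Finset.mul_prod_erase _ _ (Finset.mem_univ j)]
  congr 1
  exact Finset.prod_congr rfl fun i hi => by rw [Function.update_of_ne (Finset.ne_of_mem_erase hi)]

theorem integral_pi_apply_eq_integral_update {ι : Type*} [Fintype ι] [DecidableEq ι] {α : ι → Type*}
    [∀ i, MeasurableSpace (α i)] (P : ∀ i, Measure (α i)) [∀ i, IsProbabilityMeasure (P i)]
    (j : ι) {Φ : (∀ i, α i) × α j → ℝ} (hΦ : Measurable Φ) :
    ∫ x, Φ (x, x j) ∂Measure.pi P
      = ∫ u, Φ (Function.update u.1 j u.2, u.2) ∂(Measure.pi P).prod (P j) := by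
  have hmp := measurePreserving_update P j
  have hdiag : Measurable fun x : ∀ i, α i => Φ (x, x j) :=
    hΦ.comp (measurable_id.prodMk (measurable_pi_apply j))
  conv_lhs => rw [← hmp.map_eq]
  rw [integral_map hmp.aemeasurable hdiag.aestronglyMeasurable]
  simp only [Function.update_self]

section IsWeighting

variable {ι X Ω : Type*} [Fintype ι] [MeasurableSpace Ω]

/-- The weights `w j ω` of the data points `j` form an average for every `ω`, and none of them
exceeds `c`. The average over the first `t ω ≥ n₀` data points is the case `c = 1 / n₀`. -/
structure IsWeighting (c : ℝ) (w : ι → Ω → ℝ) : Prop where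
  measurable : ∀ j, Measurable (w j)
  mem_Icc : ∀ j ω, w j ω ∈ Set.Icc 0 c
  sum_eq_one : ∀ ω, ∑ j, w j ω = 1

/-- The weighted mean on the data set `p.1` of the query `g p.2`, chosen in view of `p.2`. -/
def empMean (w : ι → Ω → ℝ) (g : Ω → X → ℝ) (p : (ι → X) × Ω) : ℝ :=
  ∑ j, w j p.2 * g p.2 (p.1 j)

variable {c : ℝ} {w : ι → Ω → ℝ} {g : Ω → X → ℝ}

theorem IsWeighting.measurable_empMean [MeasurableSpace X] (hw : IsWeighting c w)
    (hg : Measurable (Function.uncurry g)) : Measurable (empMean w g) :=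
  Finset.measurable_fun_sum _ fun j _ => ((hw.measurable j).comp measurable_snd).mul
    (hg.comp (measurable_snd.prodMk ((measurable_pi_apply j).comp measurable_fst)))

theorem IsWeighting.empMean_mem_Icc (hw : IsWeighting c w)
    (hg01 : ∀ ω y, g ω y ∈ Set.Icc (0 : ℝ) 1) (p : (ι → X) × Ω) :
    empMean w g p ∈ Set.Icc (0 : ℝ) 1 :=
  (convex_Icc (0 : ℝ) 1).sum_mem (fun j _ => (hw.mem_Icc j p.2).1) (hw.sum_eq_one p.2)
    fun j _ => hg01 p.2 (p.1 j)

theorem IsWeighting.empMean_one_sub (hw : IsWeighting c w) (p : (ι → X) × Ω) :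
    empMean w (fun ω y => 1 - g ω y) p = 1 - empMean w g p := by
  simp only [empMean, mul_sub, mul_one, Finset.sum_sub_distrib, hw.sum_eq_one]

end IsWeighting

section ApproxDPTransfer

variable {ι X Ω : Type*} [DecidableEq ι] [MeasurableSpace Ω]

/-- `(ε, δ)`-approximate differential privacy of the output distribution `κ x` on a data set `x`,
tested against `[0, 1]`-valued functions rather than events. The parameter `δ j` belongs to
changes of the data point `j`, so that different data points may be protected differently. -/
def IsApproxDP (κ : (ι → X) → Measure Ω) (ε : ℝ) (δ : ι → ℝ) : Prop :=
  ∀ x j z, ∀ f : Ω → ℝ, Measurable f → (∀ ω, f ω ∈ Set.Icc (0 : ℝ) 1) →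
    ∫ ω, f ω ∂κ x ≤ Real.exp ε * ∫ ω, f ω ∂κ (Function.update x j z) + δ j

variable {ε : ℝ} {δ : ι → ℝ}

theorem IsApproxDP.nonneg [Nonempty X] {κ : (ι → X) → Measure Ω} (h : IsApproxDP κ ε δ) (j : ι) :
    0 ≤ δ j := by
  obtain ⟨z⟩ := ‹Nonempty X›
  simpa using h (fun _ => z) j z 0 measurable_zero (by simp)

theorem IsApproxDP.integral_le_of_mem_Icc {κ : (ι → X) → Measure Ω} (h : IsApproxDP κ ε δ) {c : ℝ}
    (hc : 0 < c) (x : ι → X) (j : ι) (z : X) {f : Ω → ℝ} (hf : Measurable f)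
    (hfc : ∀ ω, f ω ∈ Set.Icc 0 c) :
    ∫ ω, f ω ∂κ x ≤ Real.exp ε * ∫ ω, f ω ∂κ (Function.update x j z) + c * δ j := by
  have hscaled := h x j z (fun ω => f ω / c) (hf.div_const c)
    fun ω => ⟨div_nonneg (hfc ω).1 hc.le, (div_le_one hc).2 (hfc ω).2⟩
  rw [integral_div, integral_div, div_le_iff₀ hc] at hscaled
  refine hscaled.trans_eq ?_
  field_simp

variable [Fintype ι] [MeasurableSpace X] {κ : Kernel (ι → X) Ω} [IsMarkovKernel κ] {c : ℝ}

theorem IsApproxDP.integral_resample_le (h : IsApproxDP κ ε δ) (hc : 0 < c) (P : Measure X)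
    [IsProbabilityMeasure P] (j : ι) {F : X × Ω → ℝ} (hF : Measurable F)
    (hFc : ∀ p, F p ∈ Set.Icc 0 c) :
    ∫ p, F (p.1 j, p.2) ∂((Measure.pi fun _ : ι => P) ⊗ₘ κ)
      ≤ Real.exp ε * ∫ p, ∫ y, F (y, p.2) ∂P ∂((Measure.pi fun _ : ι => P) ⊗ₘ κ) + c * δ j := by
  set μ := Measure.pi fun _ : ι => P
  set Φ : (ι → X) × X → ℝ := fun u => ∫ ω, F (u.2, ω) ∂κ u.1
  have hΦ : Measurable Φ :=
    (StronglyMeasurable.integral_kernel_prod_right' (κ := Kernel.prodMkRight X κ)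
      (f := fun p => F (p.1.2, p.2)) (by fun_prop)).measurable
  have hΦi : ∀ {ν : Measure ((ι → X) × X)} [IsFiniteMeasure ν], Integrable Φ ν := fun {ν} _ =>
    .of_mem_Icc 0 c hΦ.aemeasurable
      (.of_forall fun u => integral_mem_Icc (by fun_prop) (.of_forall fun ω => hFc _))
  -- resampling the data point `j` keeps the law of the data set and exposes the old data point
  calc ∫ p, F (p.1 j, p.2) ∂(μ ⊗ₘ κ)
      = ∫ x, Φ (x, x j) ∂μ := Measure.integral_compProd
        (.of_mem_Icc 0 c (by fun_prop) (.of_forall fun p => hFc _))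
    _ = ∫ u, Φ (Function.update u.1 j u.2, u.2) ∂μ.prod P :=
        integral_pi_apply_eq_integral_update (fun _ => P) j hΦ
    _ ≤ ∫ u, (Real.exp ε * Φ u + c * δ j) ∂μ.prod P := by
        refine integral_mono ?_ ((hΦi.const_mul _).add (integrable_const _)) fun u => ?_
        · have hmap : Measurable fun u : (ι → X) × X => (Function.update u.1 j u.2, u.2) :=
            measurable_update'.prodMk measurable_snd
          exact hΦi.comp_measurable hmap
        · simpa using h.integral_le_of_mem_Icc hc (Function.update u.1 j u.2) j (u.1 j)
            (f := fun ω => F (u.2, ω)) (by fun_prop) fun ω => hFc _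
    _ = Real.exp ε * ∫ x, ∫ y, Φ (x, y) ∂P ∂μ + c * δ j := by
        rw [integral_add (hΦi.const_mul _) (integrable_const _), integral_const_mul,
          integral_prod _ hΦi, integral_const, probReal_univ, one_smul]
    _ = Real.exp ε * ∫ p, ∫ y, F (y, p.2) ∂P ∂(μ ⊗ₘ κ) + c * δ j := by
        have hFi : ∀ ω, ∫ y, F (y, ω) ∂P ∈ Set.Icc 0 c := fun ω =>
          integral_mem_Icc (by fun_prop) (.of_forall fun y => hFc _)
        have hFm : Measurable fun ω => ∫ y, F (y, ω) ∂P :=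
          (hF.stronglyMeasurable.integral_prod_left' (μ := P)).measurable
        rw [Measure.integral_compProd (f := fun p : (ι → X) × Ω => ∫ y, F (y, p.2) ∂P)
          (.of_mem_Icc 0 c (hFm.comp measurable_snd).aemeasurable (.of_forall fun p => hFi p.2))]
        congr 2
        refine integral_congr_ae (.of_forall fun x => ?_)
        change ∫ y, ∫ ω, F (y, ω) ∂κ x ∂P = ∫ ω, ∫ y, F (y, ω) ∂P ∂κ x
        exact integral_integral_swap (f := fun y ω => F (y, ω))
          (.of_mem_Icc 0 c (by fun_prop) (.of_forall fun p => hFc _))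

theorem IsApproxDP.integral_empMean_le (h : IsApproxDP κ ε δ) (hc : 0 < c) (P : Measure X)
    [IsProbabilityMeasure P] {w : ι → Ω → ℝ} (hw : IsWeighting c w) {g : Ω → X → ℝ}
    (hg : Measurable (Function.uncurry g)) (hg01 : ∀ ω y, g ω y ∈ Set.Icc (0 : ℝ) 1) :
    ∫ p, empMean w g p ∂((Measure.pi fun _ : ι => P) ⊗ₘ κ)
      ≤ Real.exp ε * ∫ p, ∫ y, g p.2 y ∂P ∂((Measure.pi fun _ : ι => P) ⊗ₘ κ)
        + c * ∑ j, δ j := by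
  set μ := (Measure.pi fun _ : ι => P) ⊗ₘ κ
  have hF : ∀ j, Measurable fun p : X × Ω => w j p.2 * g p.2 p.1 := fun j =>
    ((hw.measurable j).comp measurable_snd).mul (hg.comp measurable_swap)
  have hFc : ∀ j (p : X × Ω), w j p.2 * g p.2 p.1 ∈ Set.Icc 0 c := fun j p =>
    ⟨mul_nonneg (hw.mem_Icc j p.2).1 (hg01 p.2 p.1).1,
      (mul_le_of_le_one_right (hw.mem_Icc j p.2).1 (hg01 p.2 p.1).2).trans (hw.mem_Icc j p.2).2⟩
  have hFP : ∀ j, Measurable fun ω => ∫ y, w j ω * g ω y ∂P := fun j =>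
    ((hF j).stronglyMeasurable.integral_prod_left' (μ := P)).measurable
  calc ∫ p, empMean w g p ∂μ
      = ∑ j, ∫ p, w j p.2 * g p.2 (p.1 j) ∂μ := by
        refine integral_finsetSum _ fun j _ =>
          .of_mem_Icc 0 c ?_ (.of_forall fun p => hFc j (p.1 j, p.2))
        exact ((hF j).comp (by fun_prop : Measurable fun p : (ι → X) × Ω =>
          (p.1 j, p.2))).aemeasurable
    _ ≤ ∑ j, (Real.exp ε * ∫ p, ∫ y, w j p.2 * g p.2 y ∂P ∂μ + c * δ j) :=
        Finset.sum_le_sum fun j _ => h.integral_resample_le hc P j (hF j) (hFc j)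
    _ = Real.exp ε * ∫ p, ∑ j, ∫ y, w j p.2 * g p.2 y ∂P ∂μ + c * ∑ j, δ j := by
        rw [Finset.sum_add_distrib, ← Finset.mul_sum, ← Finset.mul_sum, integral_finsetSum]
        exact fun j _ => .of_mem_Icc 0 c ((hFP j).comp measurable_snd).aemeasurable
          (.of_forall fun p => integral_mem_Icc ((hF j).comp measurable_prodMk_right).aemeasurable
            (.of_forall fun y => hFc j (y, p.2)))
    _ = Real.exp ε * ∫ p, ∫ y, g p.2 y ∂P ∂μ + c * ∑ j, δ j := by
        simp_rw [integral_const_mul, ← Finset.sum_mul, hw.sum_eq_one, one_mul]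

theorem IsApproxDP.setIntegral_empMean_sub_le (h : IsApproxDP κ ε δ) (hε : 0 ≤ ε) (hc : 0 < c)
    (P : Measure X) [IsProbabilityMeasure P] {w : ι → Ω → ℝ} (hw : IsWeighting c w)
    {g : Ω → X → ℝ} (hg : Measurable (Function.uncurry g))
    (hg01 : ∀ ω y, g ω y ∈ Set.Icc (0 : ℝ) 1) {B : Set Ω} (hB : MeasurableSet B) :
    ∫ p in Prod.snd ⁻¹' B, (empMean w g p - ∫ y, g p.2 y ∂P) ∂((Measure.pi fun _ : ι => P) ⊗ₘ κ)
      ≤ (Real.exp ε - 1) * ((Measure.pi fun _ : ι => P) ⊗ₘ κ).real (Prod.snd ⁻¹' B)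
        + c * ∑ j, δ j := by
  set μ := (Measure.pi fun _ : ι => P) ⊗ₘ κ
  have hBm : MeasurableSet (Prod.snd ⁻¹' B : Set ((ι → X) × Ω)) := measurable_snd hB
  have hpop : Measurable fun p : (ι → X) × Ω => ∫ y, g p.2 y ∂P :=
    (hg.stronglyMeasurable.integral_prod_right' (ν := P)).measurable.comp measurable_snd
  have hpop01 : ∀ p : (ι → X) × Ω, ∫ y, g p.2 y ∂P ∈ Set.Icc (0 : ℝ) 1 := fun p =>
    integral_mem_Icc (hg.comp measurable_prodMk_left).aemeasurable (.of_forall fun y => hg01 _ y)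
  have hpopi : Integrable (fun p => ∫ y, g p.2 y ∂P) μ :=
    .of_mem_Icc 0 1 hpop.aemeasurable (.of_forall hpop01)
  have hempi : Integrable (empMean w g) μ :=
    .of_mem_Icc 0 1 (hw.measurable_empMean hg).aemeasurable
      (.of_forall (hw.empMean_mem_Icc hg01))
  have hrestrict := h.integral_empMean_le hc P hw (g := fun ω y => B.indicator (fun ω => g ω y) ω)
    (hg.indicator (measurable_fst hB)) fun ω y => by
      by_cases hω : ω ∈ B <;> simp [hω, (hg01 ω y).1, (hg01 ω y).2]
  have hemp_ind : ∀ p, empMean w (fun ω y => B.indicator (fun ω => g ω y) ω) p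
      = (Prod.snd ⁻¹' B).indicator (empMean w g) p := fun p => by
    by_cases hp : p.2 ∈ B <;> simp [empMean, hp]
  have hpop_ind : ∀ p : (ι → X) × Ω, ∫ y, B.indicator (fun ω => g ω y) p.2 ∂P
      = (Prod.snd ⁻¹' B).indicator (fun p : (ι → X) × Ω => ∫ y, g p.2 y ∂P) p := fun p => by
    by_cases hp : p.2 ∈ B <;> simp [hp]
  simp_rw [hemp_ind, hpop_ind] at hrestrict
  rw [integral_indicator hBm, integral_indicator hBm] at hrestrict
  have hpop_le : ∫ p in Prod.snd ⁻¹' B, ∫ y, g p.2 y ∂P ∂μ ≤ μ.real (Prod.snd ⁻¹' B) := by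
    simpa using integral_mono hpopi.restrict (integrable_const (1 : ℝ)) fun p => (hpop01 p).2
  rw [integral_sub hempi.restrict hpopi.restrict]
  linarith [mul_le_mul_of_nonneg_left hpop_le (sub_nonneg.2 (Real.one_le_exp hε))]

/-- The error `r - π` of an answer exceeds `α + η` only if the answer is inaccurate on the sample
or the sample mean `e` exceeds the population mean `π` by `η`. -/
theorem mul_measureReal_sub_le_setIntegral {Z : Type*} [MeasurableSpace Z] {μ : Measure Z}
    [IsFiniteMeasure μ] {e π r α : Z → ℝ} (he : Integrable e μ) (hπ : Integrable π μ)
    (he0 : ∀ z, 0 ≤ e z) (hr1 : ∀ᵐ z ∂μ, r z ≤ 1) (hα0 : ∀ z, 0 ≤ α z) {β η : ℝ}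
    (hS : MeasurableSet {z | α z < r z - e z}) (hβ : μ.real {z | α z < r z - e z} ≤ β) {B : Set Z}
    (hB : MeasurableSet B) (hBη : ∀ z ∈ B, α z + η ≤ r z - π z) :
    η * μ.real B - β ≤ ∫ z in B, (e z - π z) ∂μ := by
  set S := {z | α z < r z - e z}
  have hSi : Integrable (S.indicator fun _ => (1 : ℝ)) μ := (integrable_const 1).indicator hS
  calc η * μ.real B - β
      ≤ η * μ.real B - ∫ z in B, S.indicator (fun _ => 1) z ∂μ := by
        gcongr
        refine (setIntegral_le_integral hSi
          (.of_forall fun z => Set.indicator_nonneg (fun _ _ => zero_le_one) z)).trans ?_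
        simpa [integral_indicator_const _ hS] using hβ
    _ = ∫ z in B, (η - S.indicator (fun _ => 1) z) ∂μ := by
        rw [integral_sub (integrable_const _) hSi.restrict, setIntegral_const, smul_eq_mul,
          mul_comm]
    _ ≤ ∫ z in B, (e z - π z) ∂μ := by
        refine setIntegral_mono_on_ae ((integrable_const η).sub hSi).integrableOn
          (he.sub hπ).integrableOn hB ?_
        filter_upwards [hr1] with z hz hzB
        by_cases hzS : z ∈ S
        · rw [Set.indicator_of_mem hzS]
          linarith [hBη z hzB, hα0 z, he0 z]
        · rw [Set.indicator_of_notMem hzS]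
          have hz_accurate : r z - e z ≤ α z := not_lt.1 hzS
          linarith [hBη z hzB]

theorem IsApproxDP.measureReal_lt_sub_integral_le [Nonempty X] (h : IsApproxDP κ ε δ)
    (hε : 0 ≤ ε) (hc : 0 < c) (P : Measure X) [IsProbabilityMeasure P] {w : ι → Ω → ℝ}
    (hw : IsWeighting c w) {g : Ω → X → ℝ} (hg : Measurable (Function.uncurry g))
    (hg01 : ∀ ω y, g ω y ∈ Set.Icc (0 : ℝ) 1) {r α : Ω → ℝ} (hr : Measurable r)
    (hα : Measurable α) (hα0 : ∀ ω, 0 ≤ α ω)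
    (hr1 : ∀ᵐ p ∂((Measure.pi fun _ : ι => P) ⊗ₘ κ), r p.2 ≤ 1) {b β : ℝ} (hb : 0 < b)
    (hβ : 0 < β)
    (hsample : ((Measure.pi fun _ : ι => P) ⊗ₘ κ).real {p | α p.2 < r p.2 - empMean w g p} ≤ β) :
    ((Measure.pi fun _ : ι => P) ⊗ₘ κ).real
      {p | α p.2 + (Real.exp ε - 1 + (β + c * ∑ j, δ j) / b) < r p.2 - ∫ y, g p.2 y ∂P} ≤ b := by
  set μ := (Measure.pi fun _ : ι => P) ⊗ₘ κ
  set D := β + c * ∑ j, δ j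
  set B : Set Ω := {ω | α ω + (Real.exp ε - 1 + D / b) < r ω - ∫ y, g ω y ∂P}
  have hpop : Measurable fun ω => ∫ y, g ω y ∂P :=
    (hg.stronglyMeasurable.integral_prod_right' (ν := P)).measurable
  have hpop01 : ∀ ω, ∫ y, g ω y ∂P ∈ Set.Icc (0 : ℝ) 1 := fun ω =>
    integral_mem_Icc (hg.comp measurable_prodMk_left).aemeasurable (.of_forall fun y => hg01 _ y)
  have hemp := hw.measurable_empMean hg
  have hB : MeasurableSet B := measurableSet_lt (hα.add_const _) (hr.sub hpop)
  have hlower : (Real.exp ε - 1 + D / b) * μ.real (Prod.snd ⁻¹' B) - β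
      ≤ ∫ p in Prod.snd ⁻¹' B, (empMean w g p - ∫ y, g p.2 y ∂P) ∂μ :=
    mul_measureReal_sub_le_setIntegral (e := empMean w g) (π := fun p => ∫ y, g p.2 y ∂P)
      (α := fun p => α p.2) (r := fun p => r p.2)
      (.of_mem_Icc 0 1 hemp.aemeasurable (.of_forall (hw.empMean_mem_Icc hg01)))
      (.of_mem_Icc 0 1 (hpop.comp measurable_snd).aemeasurable (.of_forall fun p => hpop01 p.2))
      (fun p => (hw.empMean_mem_Icc hg01 p).1) hr1 (fun p => hα0 p.2)
      (measurableSet_lt (hα.comp measurable_snd) ((hr.comp measurable_snd).sub hemp))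
      hsample (measurable_snd hB) fun p hp => (show p.2 ∈ B from hp).le
  have hupper := h.setIntegral_empMean_sub_le hε hc P hw hg hg01 hB
  have hD : 0 < D :=
    add_pos_of_pos_of_nonneg hβ (mul_nonneg hc.le (Finset.sum_nonneg fun j _ => h.nonneg j))
  have hmul : D / b * μ.real (Prod.snd ⁻¹' B) ≤ D := by linarith
  rwa [div_mul_eq_mul_div, div_le_iff₀ hb, mul_le_mul_iff_right₀ hD] at hmul

section Family

theorem exists_measurable_selector {Ω I : Type*} [MeasurableSpace Ω] [MeasurableSpace I]
    [Finite I] [Nonempty I] {S : I → Set Ω} (hS : ∀ i, MeasurableSet (S i)) :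
    ∃ s : Ω → I, Measurable s ∧ ∀ ω, (∃ i, ω ∈ S i) → ω ∈ S (s ω) := by
  classical
  have := Fintype.ofFinite I
  suffices ∀ F : Finset I, ∃ s : Ω → I, Measurable s ∧ ∀ ω, (∃ i ∈ F, ω ∈ S i) → ω ∈ S (s ω) by
    simpa using this Finset.univ
  intro F
  induction F using Finset.induction_on with
  | empty => exact ⟨fun _ => Classical.arbitrary I, measurable_const, by simp⟩
  | insert a F _ ih =>
    obtain ⟨s, hs, hsF⟩ := ih
    refine ⟨fun ω => if ω ∈ S a then a else s ω, .ite (hS a) measurable_const hs, ?_⟩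
    rintro ω ⟨i, hi, hiω⟩
    by_cases ha : ω ∈ S a
    · simp [ha]
    · obtain rfl | hi := Finset.mem_insert.1 hi
      · exact absurd hiω ha
      · simpa [ha] using hsF ω ⟨i, hi, hiω⟩

theorem measurable_comp_selector {Ω I E : Type*} [MeasurableSpace Ω] [MeasurableSpace I]
    [MeasurableSpace E] [Countable I] [MeasurableSingletonClass I] {s : Ω → I}
    (hs : Measurable s) {f : I → Ω → E} (hf : ∀ i, Measurable (f i)) :
    Measurable fun ω => f (s ω) ω :=
  (measurable_from_prod_countable_left (f := fun p : Ω × I => f p.2 p.1) hf).comp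
    (measurable_id.prodMk hs)

variable {I : Type*} [Finite I] {w : I → ι → Ω → ℝ} {g : I → Ω → X → ℝ} {r : I → Ω → ℝ}
  {α : I → ℝ} {b β : ℝ}

theorem IsApproxDP.measureReal_exists_lt_sub_integral_le [Nonempty X] (h : IsApproxDP κ ε δ)
    (hε : 0 ≤ ε) (hc : 0 < c) (P : Measure X) [IsProbabilityMeasure P]
    (hw : ∀ i, IsWeighting c (w i)) (hg : ∀ i, Measurable (Function.uncurry (g i)))
    (hg01 : ∀ i ω y, g i ω y ∈ Set.Icc (0 : ℝ) 1) (hr : ∀ i, Measurable (r i))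
    (hα0 : ∀ i, 0 ≤ α i) (hr1 : ∀ᵐ p ∂((Measure.pi fun _ : ι => P) ⊗ₘ κ), ∀ i, r i p.2 ≤ 1)
    (hb : 0 < b) (hβ : 0 < β)
    (hsample : ((Measure.pi fun _ : ι => P) ⊗ₘ κ).real
      {p | ∃ i, α i < r i p.2 - empMean (w i) (g i) p} ≤ β) :
    ((Measure.pi fun _ : ι => P) ⊗ₘ κ).real
      {p | ∃ i, α i + (Real.exp ε - 1 + (β + c * ∑ j, δ j) / b)
        < r i p.2 - ∫ y, g i p.2 y ∂P} ≤ b := by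
  cases isEmpty_or_nonempty I with
  | inl => simpa using hb.le
  | inr =>
    let _ : MeasurableSpace I := ⊤
    have hpop : ∀ i, Measurable fun ω => ∫ y, g i ω y ∂P := fun i =>
      ((hg i).stronglyMeasurable.integral_prod_right' (ν := P)).measurable
    -- an inaccurate answer, if there is one, can be selected as a function of `ω`
    obtain ⟨s, hs, hsmem⟩ := exists_measurable_selector (S := fun i =>
      {ω | α i + (Real.exp ε - 1 + (β + c * ∑ j, δ j) / b) < r i ω - ∫ y, g i ω y ∂P})
      fun i => measurableSet_lt measurable_const ((hr i).sub (hpop i))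
    refine (measureReal_mono fun p hp => hsmem p.2 hp).trans
      (h.measureReal_lt_sub_integral_le hε hc P (w := fun j ω => w (s ω) j ω)
        (g := fun ω => g (s ω) ω) (r := fun ω => r (s ω) ω) (α := fun ω => α (s ω))
        ⟨fun j => measurable_comp_selector hs fun i => (hw i).measurable j,
          fun j ω => (hw (s ω)).mem_Icc j ω, fun ω => (hw (s ω)).sum_eq_one ω⟩
        (measurable_comp_selector (hs.comp measurable_fst) hg) (fun ω => hg01 _ ω)
        (measurable_comp_selector hs hr) (measurable_comp_selector hs fun _ => measurable_const)
        (fun ω => hα0 _) (hr1.mono fun p hp => hp _) hb hβ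
        ((measureReal_mono fun p hp => ?_).trans hsample))
    exact ⟨s p.2, hp⟩

theorem IsApproxDP.measureReal_exists_lt_abs_sub_integral_le [Nonempty X] (h : IsApproxDP κ ε δ)
    (hε : 0 ≤ ε) (hc : 0 < c) (P : Measure X) [IsProbabilityMeasure P]
    (hw : ∀ i, IsWeighting c (w i)) (hg : ∀ i, Measurable (Function.uncurry (g i)))
    (hg01 : ∀ i ω y, g i ω y ∈ Set.Icc (0 : ℝ) 1) (hr : ∀ i, Measurable (r i))
    (hα0 : ∀ i, 0 ≤ α i)
    (hr01 : ∀ᵐ p ∂((Measure.pi fun _ : ι => P) ⊗ₘ κ), ∀ i, r i p.2 ∈ Set.Icc (0 : ℝ) 1)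
    (hb : 0 < b) (hβ : 0 < β)
    (hsample : ((Measure.pi fun _ : ι => P) ⊗ₘ κ).real
      {p | ∃ i, α i < |r i p.2 - empMean (w i) (g i) p|} ≤ β) :
    ((Measure.pi fun _ : ι => P) ⊗ₘ κ).real
      {p | ∃ i, α i + (Real.exp ε - 1 + (β + c * ∑ j, δ j) / b)
        < |r i p.2 - ∫ y, g i p.2 y ∂P|} ≤ b := by
  have hpop : ∀ i ω, ∫ y, (1 - g i ω y) ∂P = 1 - ∫ y, g i ω y ∂P := fun i ω => by
    have hgi : Integrable (g i ω) P :=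
      .of_mem_Icc 0 1 ((hg i).comp measurable_prodMk_left).aemeasurable (.of_forall (hg01 i ω))
    rw [integral_sub (integrable_const 1) hgi, integral_const, probReal_univ, one_smul]
  -- the lower tails are the upper tails of the complementary queries and answers
  refine (measureReal_mono ?_).trans (h.measureReal_exists_lt_sub_integral_le (I := I × Bool)
    hε hc P (w := fun i => w i.1)
    (g := fun i ω y => if i.2 then g i.1 ω y else 1 - g i.1 ω y)
    (r := fun i ω => if i.2 then r i.1 ω else 1 - r i.1 ω) (α := fun i => α i.1)
    (fun i => hw i.1) ?_ ?_ ?_ (fun i => hα0 i.1) ?_ hb hβ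
    ((measureReal_mono ?_).trans hsample))
  · rintro p ⟨i, hi⟩
    rcases lt_abs.1 hi with hi | hi
    · exact ⟨(i, true), by simpa using hi⟩
    · refine ⟨(i, false), ?_⟩
      simp only [Bool.false_eq_true, if_false, hpop]
      linarith
  · rintro ⟨i, _ | _⟩
    · exact (hg i).const_sub 1
    · exact hg i
  · rintro ⟨i, _ | _⟩ ω y
    · simpa [and_comm] using hg01 i ω y
    · simpa using hg01 i ω y
  · rintro ⟨i, _ | _⟩
    · exact (hr i).const_sub 1
    · exact hr i
  · filter_upwards [hr01] with p hp
    rintro ⟨i, _ | _⟩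
    · simpa using (hp i).1
    · simpa using (hp i).2
  · rintro p ⟨⟨i, _ | _⟩, hi⟩
    · simp only [Bool.false_eq_true, if_false, (hw i).empMean_one_sub] at hi
      exact ⟨i, lt_abs.2 (.inr (by linarith))⟩
    · simp only [if_true] at hi
      exact ⟨i, lt_abs.2 (.inl hi)⟩

end Family

end ApproxDPTransfer

/-! ### The law of the transcript -/

theorem measurable_snoc {Ω : Type*} [MeasurableSpace Ω] (m : ℕ) :
    Measurable fun p : (Fin m → Ω) × Ω => Fin.snoc (α := fun _ => Ω) p.1 p.2 := by
  refine measurable_pi_lambda _ fun i => ?_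
  induction i using Fin.lastCases with
  | last => simpa using measurable_snd
  | cast i =>
    simp only [Fin.snoc_castSucc]
    fun_prop

theorem compProd_prodMkLeft_apply {Ω Ω₁ Ω₂ : Type*} [MeasurableSpace Ω] [MeasurableSpace Ω₁]
    [MeasurableSpace Ω₂] (κ : Kernel Ω Ω₁) [IsSFiniteKernel κ] (η : Kernel Ω₁ Ω₂)
    [IsSFiniteKernel η] (ω : Ω) : (κ ⊗ₖ Kernel.prodMkLeft Ω η) ω = κ ω ⊗ₘ η := by
  rw [Kernel.compProd_apply_eq_compProd_sectR]
  congr 1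

section Interact

variable {X : Type*} {n : ℕ} (M : Mechanism X) (A : Analyst X) (n₀ : ℕ) (kk : ℕ → ℕ)

theorem holderDom_interact (x x' : Fin n → X) {γ r : ℝ} (hγ : γ.HolderConjugate r) (c : ℕ → ℝ)
    (m : ℕ) (h : ∀ i < m, ∀ q, HolderDom r (ENNReal.ofReal (Real.exp (c i)))
      (M.answer _ (snapshot x (roundOf n₀ kk i)) q)
      (M.answer _ (snapshot x' (roundOf n₀ kk i)) q)) :
    HolderDom r (ENNReal.ofReal (Real.exp (∑ i ∈ Finset.range m, c i)))
      (interact M A n₀ kk x m) (interact M A n₀ kk x' m) := by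
  induction m with
  | zero => simpa [interact] using HolderDom.refl hγ _
  | succ m ih =>
    have := A.markov m
    have := M.markov _ (snapshot x (roundOf n₀ kk m))
    have := M.markov _ (snapshot x' (roundOf n₀ kk m))
    rw [Finset.sum_range_succ, Real.exp_add, ENNReal.ofReal_mul (Real.exp_pos _).le]
    refine HolderDom.map ?_ (measurable_snoc m)
    refine HolderDom.compProd hγ.symm.pos (ih fun i hi => h i (by omega)) fun p => ?_
    rw [compProd_prodMkLeft_apply, compProd_prodMkLeft_apply, ← one_mul (ENNReal.ofReal _)]
    exact HolderDom.compProd hγ.symm.pos (HolderDom.refl hγ _) (h m (by omega))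

theorem interact_preimage_eval_le (x : Fin n → X) {S : Set (StatQuery X × ℝ)}
    (hS : MeasurableSet S) {b : ℝ≥0∞} {m : ℕ} (i : Fin m)
    (h : ∀ q, M.answer _ (snapshot x (roundOf n₀ kk i)) q {r | (q, r) ∈ S} ≤ b) :
    interact M A n₀ kk x m {p | p i ∈ S} ≤ b := by
  induction m with
  | zero => exact i.elim0
  | succ m ih =>
    have := A.markov m
    have := M.markov _ (snapshot x (roundOf n₀ kk m))
    have hSi : MeasurableSet {p : Fin (m + 1) → StatQuery X × ℝ | p i ∈ S} :=
      measurable_pi_apply i hS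
    rw [interact, Measure.map_apply (measurable_snoc m) hSi]
    induction i using Fin.lastCases with
    | cast i =>
      simp only [Set.preimage_ofPred_eq, Fin.snoc_castSucc]
      have hSm : MeasurableSet {p : Fin m → StatQuery X × ℝ | p i ∈ S} := measurable_pi_apply i hS
      refine (Measure.fst_apply hSm).symm.trans_le ?_
      rw [Measure.fst_compProd]
      exact ih i h
    | last =>
      simp only [Set.preimage_ofPred_eq, Fin.snoc_last]
      change (interact M A n₀ kk x m ⊗ₘ _) (Prod.snd ⁻¹' S) ≤ b
      rw [Measure.compProd_apply (measurable_snd hS)]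
      refine (lintegral_mono fun p => ?_).trans_eq
        (by simp : ∫⁻ _, b ∂interact M A n₀ kk x m = b)
      rw [compProd_prodMkLeft_apply]
      change (A.query m p ⊗ₘ _) S ≤ b
      rw [Measure.compProd_apply hS]
      exact (lintegral_mono h).trans_eq (by simp)

theorem interact_exists_le (x : Fin n → X) {m : ℕ} {S : Fin m → Set (StatQuery X × ℝ)}
    (hS : ∀ i, MeasurableSet (S i)) {b : ℝ≥0∞}
    (h : ∀ (i : Fin m) (q), M.answer _ (snapshot x (roundOf n₀ kk i)) q {r | (q, r) ∈ S i} ≤ b) :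
    interact M A n₀ kk x m {p | ∃ i : Fin m, p i ∈ S i} ≤ m * b := by
  rw [Set.ofPred_exists]
  calc interact M A n₀ kk x m (⋃ i, {p | p i ∈ S i})
      ≤ ∑ i, interact M A n₀ kk x m {p | p i ∈ S i} := measure_iUnion_fintype_le _ _
    _ ≤ ∑ _i : Fin m, b :=
        Finset.sum_le_sum fun i _ => interact_preimage_eval_le M A n₀ kk x (hS i) i (h i)
    _ = m * b := by simp

/-- The law of the whole transcript as a kernel in the data set; `jointLaw` is by definition its
composition product with the law of the data set. -/
def interactKernel [Finite X] [MeasurableSpace X] [MeasurableSingletonClass X] (n : ℕ) :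
    Kernel (Fin n → X) (Fin (totalQueries n₀ n kk) → StatQuery X × ℝ) :=
  Kernel.ofFunOfCountable fun x => interact M A n₀ kk x (totalQueries n₀ n kk)

instance isMarkovKernel_interactKernel [Finite X] [MeasurableSpace X]
    [MeasurableSingletonClass X] (n : ℕ) : IsMarkovKernel (interactKernel M A n₀ kk n) :=
  ⟨fun x => isProbabilityMeasure_interact M A n₀ kk x _⟩

end Interact

/-! ### The complementary error function and Gaussian tails -/

theorem integrable_exp_neg_sq : Integrable fun t : ℝ => Real.exp (-t ^ 2) := by
  simpa using integrable_exp_neg_mul_sq one_pos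

theorem erfc_eq_sub (x y : ℝ) :
    erfc x = erfc y - 2 / √Real.pi * ∫ t in y..x, Real.exp (-t ^ 2) := by
  rw [erfc, erfc, ← intervalIntegral.integral_Ioi_sub_Ioi' (a := y) (b := x)
    integrable_exp_neg_sq.integrableOn integrable_exp_neg_sq.integrableOn]
  ring

theorem strictAnti_erfc : StrictAnti erfc := by
  intro y x hxy
  have hint : 0 < ∫ t in y..x, Real.exp (-t ^ 2) :=
    intervalIntegral.intervalIntegral_pos_of_pos integrable_exp_neg_sq.intervalIntegrable
      (fun t => Real.exp_pos _) hxy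
  rw [erfc_eq_sub x y]
  exact sub_lt_self _ (mul_pos (div_pos two_pos (Real.sqrt_pos.2 Real.pi_pos)) hint)

theorem continuous_erfc : Continuous erfc := by
  rw [funext fun x => erfc_eq_sub x 0]
  exact continuous_const.sub (continuous_const.mul
    (intervalIntegral.continuous_primitive (fun _ _ => integrable_exp_neg_sq.intervalIntegrable) 0))

theorem erfc_zero : erfc 0 = 1 := by
  have hgauss : ∫ t in Set.Ioi (0 : ℝ), Real.exp (-t ^ 2) = √Real.pi / 2 := by
    simpa using integral_gaussian_Ioi 1
  have hpi : √Real.pi ≠ 0 := (Real.sqrt_pos.2 Real.pi_pos).ne'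
  rw [erfc, hgauss]
  field_simp

theorem erfc_neg (x : ℝ) : erfc (-x) = 2 - erfc x := by
  have heven : ∫ t in (0 : ℝ)..-x, Real.exp (-t ^ 2) = -∫ t in (0 : ℝ)..x, Real.exp (-t ^ 2) := by
    have hcomp := intervalIntegral.integral_comp_neg (a := 0) (b := x)
      fun t : ℝ => Real.exp (-t ^ 2)
    simp only [neg_sq, neg_zero] at hcomp
    rw [intervalIntegral.integral_symm, hcomp]
  rw [erfc_eq_sub x 0, erfc_eq_sub (-x) 0, heven, erfc_zero]
  ring

theorem tendsto_erfc_atTop : Tendsto erfc atTop (𝓝 0) := by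
  have hlim := ((intervalIntegral_tendsto_integral_Ioi (μ := volume) 0
    integrable_exp_neg_sq.integrableOn tendsto_id).const_mul
      (2 / √Real.pi)).const_sub (erfc 0)
  change Tendsto _ _ (𝓝 (erfc 0 - erfc 0)) at hlim
  rw [sub_self] at hlim
  exact hlim.congr fun x => (erfc_eq_sub x 0).symm

theorem tendsto_erfc_atBot : Tendsto erfc atBot (𝓝 2) := by
  have hlim := (tendsto_erfc_atTop.comp tendsto_neg_atBot_atTop).const_sub 2
  rw [sub_zero] at hlim
  exact hlim.congr fun x => by rw [Function.comp_apply, erfc_neg, sub_sub_cancel]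

theorem erfc_pos (x : ℝ) : 0 < erfc x :=
  (strictAnti_erfc.antitone.le_of_tendsto tendsto_erfc_atTop (x + 1)).trans_lt
    (strictAnti_erfc (lt_add_one x))

theorem erfcInv_erfc (x : ℝ) : erfcInv (erfc x) = x :=
  Function.leftInverse_invFun strictAnti_erfc.injective x

theorem erfc_erfcInv {y : ℝ} (hy : y ∈ Set.Ioo (0 : ℝ) 2) : erfc (erfcInv y) = y := by
  obtain ⟨a, ha⟩ := (tendsto_erfc_atTop.eventually (gt_mem_nhds hy.1)).exists
  obtain ⟨b, hb⟩ := (tendsto_erfc_atBot.eventually (lt_mem_nhds hy.2)).exists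
  obtain ⟨x, rfl⟩ := mem_range_of_exists_le_of_exists_ge continuous_erfc ⟨a, ha.le⟩ ⟨b, hb.le⟩
  rw [erfcInv_erfc]

theorem strictAntiOn_erfcInv : StrictAntiOn erfcInv (Set.Ioo 0 2) := fun x hx y hy hxy => by
  rwa [← strictAnti_erfc.lt_iff_gt, erfc_erfcInv hx, erfc_erfcInv hy]

theorem erfcInv_pos {y : ℝ} (hy : y ∈ Set.Ioo (0 : ℝ) 1) : 0 < erfcInv y := by
  rw [← strictAnti_erfc.lt_iff_gt, erfc_erfcInv ⟨hy.1, hy.2.trans one_lt_two⟩, erfc_zero]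
  exact hy.2

theorem continuousAt_erfcInv {y : ℝ} (hy : y ∈ Set.Ioo (0 : ℝ) 2) : ContinuousAt erfcInv y := by
  have hev : ∀ᶠ z in 𝓝 y, z ∈ Set.Ioo (0 : ℝ) 2 := isOpen_Ioo.mem_nhds hy
  refine tendsto_order.2 ⟨fun a ha => ?_, fun a ha => ?_⟩
  · rw [← strictAnti_erfc.lt_iff_gt, erfc_erfcInv hy] at ha
    filter_upwards [hev, gt_mem_nhds ha] with z hz hza
    rwa [← strictAnti_erfc.lt_iff_gt, erfc_erfcInv hz]
  · rw [gt_iff_lt, ← strictAnti_erfc.lt_iff_gt, erfc_erfcInv hy] at ha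
    filter_upwards [hev, lt_mem_nhds ha] with z hz hza
    rwa [← strictAnti_erfc.lt_iff_gt, erfc_erfcInv hz]

theorem gaussianPDFReal_mul_sqrt_two {σ : ℝ} (hσ : 0 < σ) (t : ℝ) :
    gaussianPDFReal 0 (σ ^ 2).toNNReal (√2 * σ * t)
      = (√2 * σ)⁻¹ * (√Real.pi)⁻¹ * Real.exp (-t ^ 2) := by
  have hcoeff : √(2 * Real.pi * σ ^ 2) = √2 * σ * √Real.pi := by
    rw [Real.sqrt_mul (by positivity), Real.sqrt_mul zero_le_two, Real.sqrt_sq hσ.le]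
    ring
  have hexp : (√2 * σ * t) ^ 2 = 2 * σ ^ 2 * t ^ 2 := by
    rw [mul_pow, mul_pow, Real.sq_sqrt zero_le_two]
  rw [gaussianPDFReal, Real.coe_toNNReal _ (sq_nonneg σ), hcoeff, mul_inv, sub_zero, hexp,
    neg_div, mul_div_cancel_left₀ _ (by positivity)]

theorem gaussianReal_Ioi_sqrt_two {σ : ℝ} (hσ : 0 < σ) (u : ℝ) :
    gaussianReal 0 (σ ^ 2).toNNReal (Set.Ioi (√2 * σ * u)) = ENNReal.ofReal (erfc u / 2) := by
  have hv : (σ ^ 2).toNNReal ≠ 0 := (Real.toNNReal_pos.2 (by positivity)).ne'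
  have hscale : 0 < √2 * σ := by positivity
  have hsubst := integral_comp_mul_left_Ioi (gaussianPDFReal 0 (σ ^ 2).toNNReal) u hscale
  rw [smul_eq_mul, eq_inv_mul_iff_mul_eq₀ hscale.ne'] at hsubst
  rw [gaussianReal_apply_eq_integral _ hv, ← hsubst, erfc]
  simp_rw [gaussianPDFReal_mul_sqrt_two hσ]
  rw [integral_const_mul]
  congr 1
  field_simp

theorem gaussianReal_lt_abs {σ : ℝ} (hσ : 0 < σ) {u : ℝ} (hu : 0 ≤ u) :
    gaussianReal 0 (σ ^ 2).toNNReal {z | √2 * σ * u < |z|} = ENNReal.ofReal (erfc u) := by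
  set a := √2 * σ * u
  have hsplit : {z : ℝ | a < |z|} = Set.Ioi a ∪ Set.Iio (-a) := by
    ext z
    simp only [Set.mem_ofPred_eq, lt_abs, Set.mem_union, Set.mem_Ioi, Set.mem_Iio, lt_neg]
  have hsymm : gaussianReal 0 (σ ^ 2).toNNReal (Set.Iio (-a))
      = gaussianReal 0 (σ ^ 2).toNNReal (Set.Ioi a) := by
    conv_lhs => rw [← neg_zero (G := ℝ), ← gaussianReal_map_neg]
    rw [Measure.map_apply measurable_neg measurableSet_Iio]
    simp
  have hdisj : Disjoint (Set.Ioi a) (Set.Iio (-a)) :=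
    Set.disjoint_left.2 fun z (hz : a < z) (hz' : z < -a) => by
      linarith [(by positivity : 0 ≤ a)]
  have herfc : 0 ≤ erfc u / 2 := (half_pos (erfc_pos u)).le
  rw [hsplit, measure_union hdisj measurableSet_Iio, hsymm, gaussianReal_Ioi_sqrt_two hσ,
    ← ENNReal.ofReal_add herfc herfc, add_halves]

/-! ### The clipped Gaussian kernel -/

theorem measurable_clamp : Measurable clamp := by
  unfold clamp
  fun_prop

theorem clamp_mem_Icc (r : ℝ) : clamp r ∈ Set.Icc (0 : ℝ) 1 :=
  ⟨le_max_left _ _, max_le zero_le_one (min_le_right _ _)⟩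

theorem clamp_of_mem_Icc {a : ℝ} (ha : a ∈ Set.Icc (0 : ℝ) 1) : clamp a = a := by
  rw [clamp, min_eq_left ha.2, max_eq_right ha.1]

theorem abs_clamp_sub_clamp_le (a b : ℝ) : |clamp a - clamp b| ≤ |a - b| :=
  calc |clamp a - clamp b| ≤ |min a 1 - min b 1| := by
        simpa only [clamp, max_comm (0 : ℝ)] using abs_max_sub_max_le_abs (min a 1) (min b 1) 0
    _ ≤ |a - b| := by simpa using abs_min_sub_min_le_max a 1 b 1

theorem evalOn_mem_Icc {X : Type*} {m : ℕ} (q : StatQuery X) (y : Fin m → X) :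
    evalOn q y ∈ Set.Icc (0 : ℝ) 1 := by
  refine ⟨div_nonneg (Finset.sum_nonneg fun i _ => (q (y i)).2.1) (Nat.cast_nonneg m),
    div_le_one_of_le₀ ?_ (Nat.cast_nonneg m)⟩
  simpa using Finset.sum_le_sum fun i (_ : i ∈ Finset.univ) => (q (y i)).2.2

theorem measurable_evalOn {X : Type*} {m : ℕ} (y : Fin m → X) :
    Measurable fun q : StatQuery X => evalOn q y := by
  unfold evalOn
  fun_prop

theorem clippedGaussianKernel_apply {X : Type*} (s : ℝ) {m : ℕ} (y : Fin m → X)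
    (q : StatQuery X) : clippedGaussianKernel s y q
      = (gaussianReal (evalOn q y) (s ^ 2).toNNReal).map clamp := by
  rw [clippedGaussianKernel, Kernel.map_apply _ (measurable_clippedGaussian y), Kernel.prod_apply,
    Kernel.id_apply, Kernel.const_apply, Measure.dirac_prod,
    Measure.map_map (measurable_clippedGaussian y) measurable_prodMk_left,
    ← zero_add (evalOn q y), ← gaussianReal_map_const_add,
    Measure.map_map measurable_clamp (by fun_prop)]
  rfl

theorem holderDom_clippedGaussianKernel {X : Type*} {s : ℝ} (hs : s ≠ 0) {m m' : ℕ}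
    (y : Fin m → X) (y' : Fin m' → X) (q : StatQuery X) {γ r : ℝ} (hγ : γ.HolderConjugate r) :
    HolderDom r
      (ENNReal.ofReal (Real.exp ((γ - 1) * ((evalOn q y - evalOn q y') ^ 2 / (2 * s ^ 2)))))
      (clippedGaussianKernel s y q) (clippedGaussianKernel s y' q) := by
  have hv : (s ^ 2).toNNReal ≠ 0 := (Real.toNNReal_pos.2 (by positivity)).ne'
  have hgauss := holderDom_gaussianReal hγ (evalOn q y) (evalOn q y') hv
  rw [Real.coe_toNNReal _ (sq_nonneg s)] at hgauss
  rw [clippedGaussianKernel_apply, clippedGaussianKernel_apply]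
  exact hgauss.map measurable_clamp

theorem clippedGaussianKernel_compl_Icc {X : Type*} (s : ℝ) {m : ℕ} (y : Fin m → X)
    (q : StatQuery X) : clippedGaussianKernel s y q (Set.Icc 0 1)ᶜ = 0 := by
  rw [clippedGaussianKernel_apply, Measure.map_apply measurable_clamp measurableSet_Icc.compl,
    Set.preimage_compl, Set.preimage_eq_univ_iff.2, Set.compl_univ, measure_empty]
  rintro _ ⟨z, rfl⟩
  exact clamp_mem_Icc z

theorem clippedGaussianKernel_lt_abs_sub_le {X : Type*} {σ : ℝ} (hσ : 0 < σ) {m : ℕ}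
    (y : Fin m → X) (q : StatQuery X) {b : ℝ} (hb : b ∈ Set.Ioo (0 : ℝ) 1) :
    clippedGaussianKernel σ y q {r | √2 * σ * erfcInv b < |r - evalOn q y|}
      ≤ ENNReal.ofReal b := by
  rw [clippedGaussianKernel_apply, Measure.map_apply measurable_clamp
    (measurableSet_lt measurable_const (by fun_prop))]
  calc gaussianReal (evalOn q y) (σ ^ 2).toNNReal
        (clamp ⁻¹' {r | √2 * σ * erfcInv b < |r - evalOn q y|})
      ≤ gaussianReal (evalOn q y) (σ ^ 2).toNNReal
          ((fun z => z - evalOn q y) ⁻¹' {z | √2 * σ * erfcInv b < |z|}) := by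
        refine measure_mono fun z (hz : _ < |clamp z - evalOn q y|) => hz.trans_le ?_
        simpa only [clamp_of_mem_Icc (evalOn_mem_Icc q y)]
          using abs_clamp_sub_clamp_le z (evalOn q y)
    _ = gaussianReal 0 (σ ^ 2).toNNReal {z | √2 * σ * erfcInv b < |z|} := by
        rw [← Measure.map_apply (by fun_prop) (measurableSet_lt measurable_const (by fun_prop)),
          gaussianReal_map_sub_const, sub_self]
    _ = ENNReal.ofReal b := by
        rw [gaussianReal_lt_abs hσ (erfcInv_pos hb).le,
          erfc_erfcInv ⟨hb.1, hb.2.trans one_lt_two⟩]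

/-! ### Rounds and snapshots -/

theorem totalQueries_mono (n₀ : ℕ) (kk : ℕ → ℕ) : Monotone fun t => totalQueries n₀ t kk :=
  fun _ _ h => Finset.sum_le_sum_of_subset (Finset.Icc_subset_Icc_right h)

theorem roundOf_eq {n₀ : ℕ} {kk : ℕ → ℕ} {i t : ℕ} (h : i < totalQueries n₀ t kk)
    (h' : ∀ s < t, totalQueries n₀ s kk ≤ i) : roundOf n₀ kk i = t :=
  le_antisymm (Nat.sInf_le h) <| le_of_not_gt fun hlt => (h' _ hlt).not_gt
    (Nat.sInf_mem (s := {t | i < ∑ τ ∈ Finset.Icc n₀ t, kk τ}) ⟨t, h⟩)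

theorem roundOf_mem_Icc {n₀ n : ℕ} {kk : ℕ → ℕ} {i : ℕ} (h : i < totalQueries n₀ n kk) :
    roundOf n₀ kk i ∈ Finset.Icc n₀ n := by
  refine Finset.mem_Icc.2 ⟨le_of_not_gt fun hlt => ?_, Nat.sInf_le h⟩
  have hi : i < ∑ τ ∈ Finset.Icc n₀ (roundOf n₀ kk i), kk τ :=
    Nat.sInf_mem (s := {t | i < ∑ τ ∈ Finset.Icc n₀ t, kk τ}) ⟨n, h⟩
  rw [Finset.Icc_eq_empty hlt.not_ge, Finset.sum_empty] at hi
  exact Nat.not_lt_zero i hi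

theorem sum_roundOf {n₀ n : ℕ} (hn : n₀ ≤ n) (kk : ℕ → ℕ) (g : ℕ → ℝ) :
    ∑ i ∈ Finset.range (totalQueries n₀ n kk), g (roundOf n₀ kk i)
      = ∑ τ ∈ Finset.Icc n₀ n, kk τ * g τ := by
  induction n, hn using Nat.le_induction with
  | base =>
    have hround : ∀ i ∈ Finset.range (totalQueries n₀ n₀ kk), g (roundOf n₀ kk i) = g n₀ :=
      fun i hi => by
        have hmem := roundOf_mem_Icc (Finset.mem_range.1 hi)
        rw [Finset.Icc_self, Finset.mem_singleton] at hmem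
        rw [hmem]
    rw [Finset.sum_congr rfl hround]
    simp [totalQueries]
  | succ n hn ih =>
    have htot : totalQueries n₀ (n + 1) kk = totalQueries n₀ n kk + kk (n + 1) :=
      Finset.sum_Icc_succ_top (by omega) _
    have hround : ∀ i ∈ Finset.range (kk (n + 1)),
        g (roundOf n₀ kk (totalQueries n₀ n kk + i)) = g (n + 1) := fun i hi => by
      rw [Finset.mem_range] at hi
      rw [roundOf_eq (i := totalQueries n₀ n kk + i) (t := n + 1) (by omega) fun s hs =>
        (totalQueries_mono n₀ kk (Nat.lt_succ_iff.1 hs)).trans (Nat.le_add_right _ _)]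
    rw [htot, Finset.sum_range_add, ih, Finset.sum_Icc_succ_top (by omega),
      Finset.sum_congr rfl hround]
    simp

/-- The weight of the data point `j` in the empirical mean over the first `t` data points. -/
def prefixWeight {n : ℕ} (t : ℕ) (j : Fin n) : ℝ := if (j : ℕ) < t then (t : ℝ)⁻¹ else 0

theorem evalOn_snapshot {X : Type*} {n t : ℕ} (ht : t ≤ n) (q : StatQuery X) (x : Fin n → X) :
    evalOn q (snapshot x t) = ∑ j, prefixWeight t j * q (x j) := by
  have hprefix : ∀ {m : ℕ} (hm : m ≤ n) (f : Fin n → ℝ),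
      ∑ i : Fin m, f (Fin.castLE hm i) = ∑ j : Fin n, if (j : ℕ) < m then f j else 0 := by
    intro m hm f
    obtain ⟨d, rfl⟩ := Nat.exists_eq_add_of_le hm
    simp [Fin.sum_univ_add]
    rfl
  rw [evalOn]
  simp only [snapshot]
  rw [hprefix (min_le_right t n) fun j => (q (x j) : ℝ), min_eq_left ht, Finset.sum_div]
  refine Finset.sum_congr rfl fun j _ => ?_
  rw [prefixWeight, ite_div, zero_div, ite_mul, zero_mul, div_eq_inv_mul]

theorem sum_prefixWeight {n t : ℕ} (ht0 : t ≠ 0) (ht : t ≤ n) :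
    ∑ j : Fin n, prefixWeight t j = 1 := by
  have hone := evalOn_snapshot ht (fun _ : Unit => 1) fun _ => ()
  simp only [evalOn, Set.Icc.coe_one, mul_one] at hone
  rw [← hone, Finset.sum_const, Finset.card_univ, Fintype.card_fin, nsmul_one, min_eq_left ht,
    div_self (Nat.cast_ne_zero.2 ht0)]

theorem isWeighting_prefixWeight {Ω : Type*} [MeasurableSpace Ω] {n₀ n t : ℕ} (hn₀ : 0 < n₀)
    (ht : t ∈ Finset.Icc n₀ n) :
    IsWeighting (n₀ : ℝ)⁻¹ fun (j : Fin n) (_ : Ω) => prefixWeight t j where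
  measurable _ := measurable_const
  mem_Icc j _ := by
    have hle : (t : ℝ)⁻¹ ≤ (n₀ : ℝ)⁻¹ := by gcongr; exact (Finset.mem_Icc.1 ht).1
    unfold prefixWeight
    split_ifs
    · exact ⟨by positivity, hle⟩
    · exact ⟨le_rfl, by positivity⟩
  sum_eq_one _ := sum_prefixWeight (hn₀.trans_le (Finset.mem_Icc.1 ht).1).ne'
    (Finset.mem_Icc.1 ht).2

theorem sq_evalOn_snapshot_sub_le {X : Type*} {n t : ℕ} (ht : t ≤ n) (q : StatQuery X)
    (x : Fin n → X) (j : Fin n) (z : X) :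
    (evalOn q (snapshot x t) - evalOn q (snapshot (Function.update x j z) t)) ^ 2
      ≤ prefixWeight t j ^ 2 := by
  have hdiff : evalOn q (snapshot x t) - evalOn q (snapshot (Function.update x j z) t)
      = prefixWeight t j * (q (x j) - q z) := by
    rw [evalOn_snapshot ht, evalOn_snapshot ht, ← Finset.sum_sub_distrib,
      Finset.sum_eq_single j (fun i _ hij => by rw [Function.update_of_ne hij, sub_self])
        (fun hj => absurd (Finset.mem_univ j) hj), Function.update_self, mul_sub]
  have hq : (q (x j) - q z : ℝ) ^ 2 ≤ 1 := (sq_le_one_iff_abs_le_one _).2 <| abs_le.2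
    ⟨by linarith [(q (x j)).2.1, (q z).2.2], by linarith [(q (x j)).2.2, (q z).2.1]⟩
  rw [hdiff, mul_pow]
  exact mul_le_of_le_one_right (sq_nonneg _) hq

/-! ### Transcripts of the clipped Gaussian mechanism -/

section Transcript

variable {X : Type*} {n₀ n : ℕ} {kk : ℕ → ℕ} {σ : ℕ → ℝ}

theorem interact_clippedGaussian_lt_abs_sub_evalOn_le (hσ : ∀ t ∈ Finset.Icc n₀ n, 0 < σ t)
    (A : Analyst X) (x : Fin n → X) {b : ℝ} (hb : b ∈ Set.Ioo (0 : ℝ) 1) :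
    interact (clippedGaussian X σ) A n₀ kk x (totalQueries n₀ n kk)
      {p | ∃ i : Fin _, √2 * σ (roundOf n₀ kk i) * erfcInv b
        < |(p i).2 - evalOn (p i).1 (snapshot x (roundOf n₀ kk i))|}
      ≤ totalQueries n₀ n kk * ENNReal.ofReal b := by
  refine interact_exists_le _ A n₀ kk x (S := fun i => {z | √2 * σ (roundOf n₀ kk i) * erfcInv b
    < |z.2 - evalOn z.1 (snapshot x (roundOf n₀ kk i))|}) (fun i => ?_) fun i q => ?_
  · exact measurableSet_lt measurable_const
      (measurable_snd.sub ((measurable_evalOn _).comp measurable_fst)).abs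
  · have hround := roundOf_mem_Icc i.2
    have htail := clippedGaussianKernel_lt_abs_sub_le (hσ _ hround)
      (snapshot x (roundOf n₀ kk i)) q hb
    change clippedGaussianKernel (σ (min _ n)) _ q _ ≤ _
    have hσmin : σ (min (roundOf n₀ kk i) n) = σ (roundOf n₀ kk i) := by
      rw [min_eq_left (Finset.mem_Icc.1 hround).2]
    rwa [hσmin]

theorem ae_interact_clippedGaussian_mem_Icc (A : Analyst X) (x : Fin n → X) (m : ℕ) :
    ∀ᵐ p ∂interact (clippedGaussian X σ) A n₀ kk x m, ∀ i, (p i).2 ∈ Set.Icc (0 : ℝ) 1 :=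
  ae_all_iff.2 fun i => nonpos_iff_eq_zero.1 <|
    interact_preimage_eval_le _ A n₀ kk x (S := Prod.snd ⁻¹' (Set.Icc 0 1)ᶜ)
      (measurable_snd measurableSet_Icc.compl) i
      fun q => (clippedGaussianKernel_compl_Icc _ _ q).le

variable [Finite X] [MeasurableSpace X] [MeasurableSingletonClass X]

theorem isApproxDP_interactKernel (hn : n₀ ≤ n) (hσ : ∀ t ∈ Finset.Icc n₀ n, σ t ≠ 0)
    (A : Analyst X) {γ : ℝ} (hγ : 1 < γ) (ε : ℝ) :
    IsApproxDP (interactKernel (clippedGaussian X σ) A n₀ kk n) ε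
      fun j => psi γ (rho n₀ n kk σ (j + 1)) ε := by
  intro x j z f hf hf01
  have hconj := Real.HolderConjugate.conjExponent hγ
  refine HolderDom.integral_le_add_psi hconj ?_ hf hf01 ε
  let cost : ℕ → ℝ := fun t => (γ - 1) * (prefixWeight t j ^ 2 / (2 * σ t ^ 2))
  have hcost : ∑ i ∈ Finset.range (totalQueries n₀ n kk), cost (roundOf n₀ kk i)
      = (γ - 1) * rho n₀ n kk σ (j + 1) := by
    rw [sum_roundOf hn, rho, Finset.mul_sum]
    refine Finset.sum_congr rfl fun t _ => ?_
    simp only [cost, prefixWeight, Nat.add_one_le_iff]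
    split_ifs
    · ring
    · simp
  rw [← hcost]
  refine holderDom_interact _ A n₀ kk x _ hconj (fun i => cost (roundOf n₀ kk i)) _ fun i hi q => ?_
  have hround := roundOf_mem_Icc hi
  have hle := (Finset.mem_Icc.1 hround).2
  have hdom := holderDom_clippedGaussianKernel (hσ _ hround) (snapshot x (roundOf n₀ kk i))
    (snapshot (Function.update x j z) (roundOf n₀ kk i)) q hconj
  change HolderDom _ _ (clippedGaussianKernel (σ (min _ n)) _ q)
    (clippedGaussianKernel (σ (min _ n)) _ q)
  have hσmin : σ (min (roundOf n₀ kk i) n) = σ (roundOf n₀ kk i) := by rw [min_eq_left hle]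
  rw [hσmin]
  have : 0 ≤ γ - 1 := sub_nonneg.2 hγ.le
  refine hdom.mono (ENNReal.ofReal_le_ofReal (Real.exp_le_exp.2 ?_))
  dsimp only [cost]
  gcongr (_ * (?_ / _))
  exact sq_evalOn_snapshot_sub_le hle q x j z

end Transcript

/-! ### Distributional accuracy -/

section Accuracy

variable {X : Type*} [Finite X] [MeasurableSpace X] [MeasurableSingletonClass X]

theorem popValue_mem_Icc (q : StatQuery X) (P : Measure X) [IsProbabilityMeasure P] (t : ℕ) :
    popValue q P t ∈ Set.Icc (0 : ℝ) 1 :=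
  integral_mem_Icc (measurable_of_finite _).aemeasurable (.of_forall (evalOn_mem_Icc q))

theorem popValue_eq_integral (q : StatQuery X) (P : Measure X) [IsProbabilityMeasure P] {t : ℕ}
    (ht : t ≠ 0) : popValue q P t = ∫ y, (q y : ℝ) ∂P := by
  have hcoord : ∀ i : Fin t, ∫ y, (q (y i) : ℝ) ∂(Measure.pi fun _ : Fin t => P)
      = ∫ y, (q y : ℝ) ∂P := fun i =>
    integral_comp_eval (μ := fun _ : Fin t => P) (f := fun y : X => (q y : ℝ))
      (measurable_of_finite _).aestronglyMeasurable
  unfold popValue evalOn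
  rw [integral_div, integral_finsetSum _ fun i _ => Integrable.of_finite]
  simp only [hcoord, Finset.sum_const, Finset.card_univ, Fintype.card_fin, nsmul_eq_mul]
  field_simp

theorem measurable_popValue (P : Measure X) [IsProbabilityMeasure P] (t : ℕ) :
    Measurable fun q : StatQuery X => popValue q P t := by
  have heval : Measurable fun p : StatQuery X × (Fin t → X) => evalOn p.1 p.2 :=
    measurable_from_prod_countable_left fun y => measurable_evalOn y
  exact heval.stronglyMeasurable.integral_prod_right'.measurable

instance isProbabilityMeasure_jointLaw (M : Mechanism X) (A : Analyst X) (n₀ n : ℕ) (kk : ℕ → ℕ)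
    (P : Measure X) [IsProbabilityMeasure P] : IsProbabilityMeasure (jointLaw M A n₀ n kk P) :=
  inferInstanceAs (IsProbabilityMeasure ((Measure.pi fun _ => P) ⊗ₘ interactKernel M A n₀ kk n))

theorem distAccurate_iff {M : Mechanism X} {n₀ n : ℕ} {kk : ℕ → ℕ} {α : ℕ → ℝ} {b : ℝ} :
    DistAccurate M n₀ n kk α b ↔ ∀ (A : Analyst X) (P : Measure X) [IsProbabilityMeasure P],
      (jointLaw M A n₀ n kk P).real {p | ∃ i : Fin _, α (roundOf n₀ kk i)
        < |(p.2 i).2 - popValue (p.2 i).1 P (roundOf n₀ kk i)|} ≤ b := by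
  refine forall₃_congr fun A P hP => ?_
  have hmeas : MeasurableSet {p : (Fin n → X) × (Fin (totalQueries n₀ n kk) → StatQuery X × ℝ) |
      ∃ i : Fin _, α (roundOf n₀ kk i) < |(p.2 i).2 - popValue (p.2 i).1 P (roundOf n₀ kk i)|} := by
    have hresp : ∀ i, Measurable fun p :
        (Fin n → X) × (Fin (totalQueries n₀ n kk) → StatQuery X × ℝ) => p.2 i := by fun_prop
    rw [Set.ofPred_exists]
    exact .iUnion fun i => measurableSet_lt measurable_const
      (((hresp i).snd.sub ((measurable_popValue P _).comp (hresp i).fst)).abs)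
  have hcompl : {p : (Fin n → X) × (Fin (totalQueries n₀ n kk) → StatQuery X × ℝ) |
      ∀ t ∈ Finset.Icc n₀ n, ∀ i : Fin (totalQueries n₀ n kk), roundOf n₀ kk i = t →
        |(p.2 i).2 - popValue (p.2 i).1 P t| ≤ α t}
      = {p | ∃ i : Fin _, α (roundOf n₀ kk i)
        < |(p.2 i).2 - popValue (p.2 i).1 P (roundOf n₀ kk i)|}ᶜ := by
    ext p
    simp only [Set.mem_ofPred_eq, Set.mem_compl_iff, not_exists, not_lt]
    exact ⟨fun hp i => hp _ (roundOf_mem_Icc i.2) i rfl, fun hp t _ i hi => hi ▸ hp i⟩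
  rw [hcompl, probReal_compl_eq_one_sub hmeas, sub_le_sub_iff_left]

theorem ae_jointLaw_clippedGaussian_mem_Icc (σ : ℕ → ℝ) (A : Analyst X) (n₀ n : ℕ) (kk : ℕ → ℕ)
    (P : Measure X) [IsProbabilityMeasure P] :
    ∀ᵐ p ∂jointLaw (clippedGaussian X σ) A n₀ n kk P, ∀ i, (p.2 i).2 ∈ Set.Icc (0 : ℝ) 1 :=
  Measure.ae_compProd_of_ae_ae (κ := interactKernel (clippedGaussian X σ) A n₀ kk n)
    (by
      simp only [Set.ofPred_forall]
      exact .iInter fun i =>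
        (by fun_prop : Measurable fun p :
          (Fin n → X) × (Fin (totalQueries n₀ n kk) → StatQuery X × ℝ) => (p.2 i).2)
          measurableSet_Icc)
    (.of_forall fun x => ae_interact_clippedGaussian_mem_Icc A x _)

theorem DistAccurate.mono {M : Mechanism X} {n₀ n : ℕ} {kk : ℕ → ℕ} {α α' : ℕ → ℝ} {b : ℝ}
    (h : DistAccurate M n₀ n kk α b) (hα : ∀ t, α t ≤ α' t) : DistAccurate M n₀ n kk α' b :=
  distAccurate_iff.2 fun A P _ => by
    refine le_trans (measureReal_mono ?_) (distAccurate_iff.1 h A P)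
    exact fun p ⟨i, hi⟩ => ⟨i, (hα _).trans_lt hi⟩

theorem distAccurate_clippedGaussian_of_one_le (σ : ℕ → ℝ) (n₀ n : ℕ) (kk : ℕ → ℕ) {α : ℕ → ℝ}
    {b : ℝ} (hα : ∀ t, 1 ≤ α t) (hb : 0 ≤ b) :
    DistAccurate (clippedGaussian X σ) n₀ n kk α b := by
  refine distAccurate_iff.2 fun A P hP => le_of_eq_of_le ?_ hb
  rw [measureReal_eq_zero_iff]
  refine measure_mono_null ?_ (ae_jointLaw_clippedGaussian_mem_Icc σ A n₀ n kk P)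
  rintro p ⟨i, hi⟩ hp
  have hR := hp i
  have hpop := popValue_mem_Icc (p.2 i).1 P (roundOf n₀ kk i)
  exact hi.not_ge <| (abs_le.2 ⟨by linarith [hR.1, hpop.2], by linarith [hR.2, hpop.1]⟩).trans
    (hα (roundOf n₀ kk i))

theorem jointLaw_clippedGaussian_lt_abs_sub_evalOn_le {n₀ n : ℕ} {kk : ℕ → ℕ} {σ : ℕ → ℝ}
    (hσ : ∀ t ∈ Finset.Icc n₀ n, 0 < σ t) (A : Analyst X) (P : Measure X) [IsProbabilityMeasure P]
    {b : ℝ} (hb : b ∈ Set.Ioo (0 : ℝ) 1) :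
    (jointLaw (clippedGaussian X σ) A n₀ n kk P).real
      {p | ∃ i : Fin _, √2 * σ (roundOf n₀ kk i) * erfcInv b
        < |(p.2 i).2 - evalOn (p.2 i).1 (snapshot p.1 (roundOf n₀ kk i))|}
      ≤ totalQueries n₀ n kk * b := by
  have hmeas : MeasurableSet {p : (Fin n → X) × (Fin (totalQueries n₀ n kk) → StatQuery X × ℝ) |
      ∃ i : Fin _, √2 * σ (roundOf n₀ kk i) * erfcInv b
        < |(p.2 i).2 - evalOn (p.2 i).1 (snapshot p.1 (roundOf n₀ kk i))|} := by
    rw [Set.ofPred_exists]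
    refine .iUnion fun i => measurableSet_lt measurable_const ?_
    refine measurable_from_prod_countable_right fun x => ?_
    have hresp : Measurable fun p : Fin (totalQueries n₀ n kk) → StatQuery X × ℝ => p i :=
      measurable_pi_apply i
    exact (hresp.snd.sub ((measurable_evalOn _).comp hresp.fst)).abs
  refine ENNReal.toReal_le_of_le_ofReal (mul_nonneg (Nat.cast_nonneg _) hb.1.le) ?_
  change ((Measure.pi fun _ => P) ⊗ₘ interactKernel _ A n₀ kk n) _ ≤ _
  rw [Measure.compProd_apply hmeas, ENNReal.ofReal_mul (Nat.cast_nonneg _), ENNReal.ofReal_natCast]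
  exact (lintegral_mono fun x => interact_clippedGaussian_lt_abs_sub_evalOn_le hσ A x hb).trans_eq
    (by simp)

theorem sum_Icc_one_eq_sum_fin {M : Type*} [AddCommMonoid M] (f : ℕ → M) (n : ℕ) :
    ∑ t ∈ Finset.Icc 1 n, f t = ∑ j : Fin n, f (j + 1) := by
  rw [Fin.sum_univ_eq_sum_range fun j => f (j + 1), Finset.range_eq_Ico,
    Finset.sum_Ico_add' f, zero_add, Finset.Ico_add_one_right_eq_Icc]

theorem div_totalQueries_mem_Ioo {n₀ n : ℕ} {kk : ℕ → ℕ} (hk : 1 ≤ totalQueries n₀ n kk) {β : ℝ}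
    (hβ : β ∈ Set.Ioo (0 : ℝ) 1) : β / totalQueries n₀ n kk ∈ Set.Ioo (0 : ℝ) 1 :=
  have hk' : (1 : ℝ) ≤ totalQueries n₀ n kk := by exact_mod_cast hk
  ⟨div_pos hβ.1 (by linarith), (div_lt_one (by linarith)).2 (by linarith [hβ.2])⟩

theorem distAccurate_clippedGaussian {n₀ n : ℕ} (hn₀ : 1 ≤ n₀) (hn : n₀ ≤ n) {kk : ℕ → ℕ}
    (hk : 1 ≤ totalQueries n₀ n kk) {σ : ℕ → ℝ} (hσ : ∀ t ∈ Finset.Icc n₀ n, 0 < σ t) {β ε γ b : ℝ}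
    (hβ : β ∈ Set.Ioo (0 : ℝ) 1) (hε : 0 ≤ ε) (hγ : 1 < γ) (hb : 0 < b) :
    DistAccurate (clippedGaussian X σ) n₀ n kk
      (fun t => √2 * σ t * erfcInv (β / totalQueries n₀ n kk) + (Real.exp ε - 1
        + (β + (∑ t ∈ Finset.Icc 1 n, psi γ (rho n₀ n kk σ t) ε) / n₀) / b)) b := by
  refine distAccurate_iff.2 fun A P _ => ?_
  have : Nonempty X := nonempty_of_isProbabilityMeasure P
  have hround := fun i : Fin (totalQueries n₀ n kk) => roundOf_mem_Icc i.2
  have hround0 : ∀ i : Fin (totalQueries n₀ n kk), roundOf n₀ kk i ≠ 0 := fun i =>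
    Nat.one_le_iff_ne_zero.1 (hn₀.trans (Finset.mem_Icc.1 (hround i)).1)
  have hk' : (0 : ℝ) < totalQueries n₀ n kk := by exact_mod_cast hk
  have hbk : β / totalQueries n₀ n kk ∈ Set.Ioo (0 : ℝ) 1 := div_totalQueries_mem_Ioo hk hβ
  have htransfer := (isApproxDP_interactKernel (kk := kk) hn (fun t ht => (hσ t ht).ne') A hγ
    ε).measureReal_exists_lt_abs_sub_integral_le hε (inv_pos.2 (Nat.cast_pos.2 hn₀)) P
    (w := fun (i : Fin (totalQueries n₀ n kk)) j _ => prefixWeight (roundOf n₀ kk i) j)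
    (g := fun i ω y => (ω i).1 y) (r := fun i ω => (ω i).2)
    (α := fun i => √2 * σ (roundOf n₀ kk i) * erfcInv (β / totalQueries n₀ n kk))
    (fun i => isWeighting_prefixWeight hn₀ (hround i))
    (fun i => measurable_from_prod_countable_left fun y =>
      ((measurable_pi_apply y).comp (measurable_pi_apply i).fst).subtype_coe)
    (fun i ω y => ((ω i).1 y).2) (fun i => by fun_prop)
    (fun i => mul_nonneg (mul_nonneg (Real.sqrt_nonneg 2) (hσ _ (hround i)).le)
      (erfcInv_pos hbk).le)
    (ae_jointLaw_clippedGaussian_mem_Icc σ A n₀ n kk P) hb hβ.1 ?_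
  · rw [sum_Icc_one_eq_sum_fin, div_eq_inv_mul _ (n₀ : ℝ)]
    simp only [popValue_eq_integral _ P (hround0 _)]
    exact htransfer
  · have hsample := jointLaw_clippedGaussian_lt_abs_sub_evalOn_le (kk := kk) hσ A P hbk
    rw [mul_div_cancel₀ _ hk'.ne'] at hsample
    simp only [evalOn_snapshot (Finset.mem_Icc.1 (hround _)).2] at hsample
    exact hsample

end Accuracy

/-! ### The optimal order -/

section OptimalOrder

variable {γ ρ : ℝ}

/-- The logarithm of `psi` on `1 < γ`. Its derivative is a sum of increasing functions of `γ`,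
so that minimizing `psi` is a convex problem. -/
def logPsi (γ ρ ε : ℝ) : ℝ :=
  (γ - 1) * (γ * ρ - ε) + γ * Real.log (1 - γ⁻¹) - Real.log (γ - 1)

/-- The derivative of `logPsi` in the order `γ`; its zero is the optimal order. -/
def logPsiDeriv (γ ρ ε : ℝ) : ℝ := (2 * γ - 1) * ρ - ε + Real.log (1 - γ⁻¹)

theorem psi_eq_exp_logPsi (hγ : 1 < γ) (ρ ε : ℝ) : psi γ ρ ε = Real.exp (logPsi γ ρ ε) := by
  rw [logPsi, Real.exp_sub, Real.exp_add, Real.exp_log (sub_pos.2 hγ), psi,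
    Real.rpow_def_of_pos (one_sub_inv_pos hγ), mul_comm γ (Real.log _)]

theorem hasDerivAt_logPsi (hγ : 1 < γ) (ρ ε : ℝ) :
    HasDerivAt (fun g => logPsi g ρ ε) (logPsiDeriv γ ρ ε) γ := by
  have hγ0 : γ ≠ 0 := by linarith
  have hγ1 : γ - 1 ≠ 0 := by linarith
  have hsub : HasDerivAt (fun g : ℝ => g - 1) 1 γ := (hasDerivAt_id γ).sub_const 1
  have haffine : HasDerivAt (fun g : ℝ => g * ρ - ε) (1 * ρ) γ :=
    ((hasDerivAt_id γ).mul_const ρ).sub_const ε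
  have hlog := ((hasDerivAt_inv hγ0).const_sub 1).log (one_sub_inv_pos hγ).ne'
  refine (((hsub.mul haffine).add ((hasDerivAt_id γ).mul hlog)).sub
    (hsub.log hγ1)).congr_deriv ?_
  have hinv : 1 - γ⁻¹ = (γ - 1) / γ := by field_simp
  simp only [logPsiDeriv, id]
  generalize Real.log (1 - γ⁻¹) = l
  rw [hinv]
  field_simp
  ring

theorem strictMonoOn_logPsiDeriv (hρ : 0 ≤ ρ) (ε : ℝ) :
    StrictMonoOn (fun γ => logPsiDeriv γ ρ ε) (Set.Ioi 1) := by
  intro a ha b _ hab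
  have ha1 : 1 < a := ha
  have hlog : Real.log (1 - a⁻¹) < Real.log (1 - b⁻¹) :=
    Real.log_lt_log (one_sub_inv_pos ha) (by gcongr)
  have hlin : (2 * a - 1) * ρ ≤ (2 * b - 1) * ρ := by gcongr
  simp only [logPsiDeriv]
  linarith

theorem tendsto_logPsiDeriv_nhdsGT_one (ρ ε : ℝ) :
    Tendsto (fun γ => logPsiDeriv γ ρ ε) (𝓝[>] 1) atBot := by
  have hlin : Tendsto (fun γ : ℝ => (2 * γ - 1) * ρ - ε) (𝓝[>] 1) (𝓝 ((2 * 1 - 1) * ρ - ε)) :=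
    (Continuous.tendsto (by fun_prop) 1).mono_left nhdsWithin_le_nhds
  have hinv : Tendsto (fun γ : ℝ => 1 - γ⁻¹) (𝓝[>] 1) (𝓝[>] 0) := by
    refine tendsto_nhdsWithin_iff.2 ⟨?_, eventually_mem_nhdsWithin.mono fun γ => one_sub_inv_pos⟩
    have hcont : ContinuousAt (fun γ : ℝ => 1 - γ⁻¹) 1 := by fun_prop (disch := norm_num)
    simpa using hcont.tendsto.mono_left nhdsWithin_le_nhds
  exact hlin.add_atBot (Real.tendsto_log_nhdsGT_zero.comp hinv)

theorem tendsto_logPsiDeriv_atTop (hρ : 0 < ρ) (ε : ℝ) :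
    Tendsto (fun γ => logPsiDeriv γ ρ ε) atTop atTop := by
  have hlin : Tendsto (fun γ : ℝ => (2 * γ - 1) * ρ - ε) atTop atTop :=
    tendsto_atTop_add_const_right _ (-ε) <|
      (tendsto_atTop_add_const_right _ (-1) (tendsto_id.const_mul_atTop two_pos)).atTop_mul_const hρ
  have hlog : Tendsto (fun γ : ℝ => Real.log (1 - γ⁻¹)) atTop (𝓝 0) := by
    simpa using (tendsto_inv_atTop_zero.const_sub (1 : ℝ)).log (by norm_num)
  exact hlin.atTop_add hlog

theorem exists_logPsiDeriv_eq_zero (hρ : 0 < ρ) (ε : ℝ) : ∃ γ, 1 < γ ∧ logPsiDeriv γ ρ ε = 0 := by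
  have hcont : ContinuousOn (fun γ => logPsiDeriv γ ρ ε) (Set.Ioi 1) := fun γ hγ => by
    have hγ0 : γ ≠ 0 := (one_pos.trans hγ).ne'
    have hne : 1 - γ⁻¹ ≠ 0 := (one_sub_inv_pos hγ).ne'
    unfold logPsiDeriv
    exact ContinuousAt.continuousWithinAt (by fun_prop (disch := assumption))
  obtain ⟨γ, hγ, hzero⟩ := isPreconnected_Ioi.intermediate_value_Iii
    (le_principal_iff.2 self_mem_nhdsWithin) (le_principal_iff.2 (Ioi_mem_atTop 1)) hcont
    (tendsto_logPsiDeriv_nhdsGT_one ρ ε) (tendsto_logPsiDeriv_atTop hρ ε) (Set.mem_univ 0)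
  exact ⟨γ, hγ, hzero⟩

theorem isMinOn_logPsi (hρ : 0 ≤ ρ) {ε : ℝ} (hγ : 1 < γ) (h : logPsiDeriv γ ρ ε = 0) :
    IsMinOn (fun g => logPsi g ρ ε) (Set.Ioi 1) γ := by
  have hmono := strictMonoOn_logPsiDeriv hρ ε
  refine isMinOn_Ioi_of_deriv (hasDerivAt_logPsi hγ ρ ε).continuousAt
    (fun g hg => (hasDerivAt_logPsi hg.1 ρ ε).differentiableAt.differentiableWithinAt)
    (fun g hg => (hasDerivAt_logPsi (hγ.trans hg) ρ ε).differentiableAt.differentiableWithinAt)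
    (fun g hg => ?_) (fun g hg => ?_)
  · rw [(hasDerivAt_logPsi hg.1 ρ ε).deriv, ← h]
    exact (hmono hg.1 hγ hg.2).le
  · rw [(hasDerivAt_logPsi (hγ.trans hg) ρ ε).deriv, ← h]
    exact (hmono hγ (hγ.trans hg) hg).le

theorem isMinOn_psi_iff (hγ : 1 < γ) (ρ ε : ℝ) :
    IsMinOn (fun g => psi g ρ ε) (Set.Ioi 1) γ
      ↔ IsMinOn (fun g => logPsi g ρ ε) (Set.Ioi 1) γ := by
  simp only [isMinOn_iff]
  refine forall₂_congr fun g hg => ?_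
  rw [psi_eq_exp_logPsi hγ, psi_eq_exp_logPsi hg, Real.exp_le_exp]

theorem gammaStar_spec (hρ : 0 < ρ) (ε : ℝ) :
    1 < gammaStar ρ ε ∧ logPsiDeriv (gammaStar ρ ε) ρ ε = 0 := by
  obtain ⟨γ, hγ, hzero⟩ := exists_logPsiDeriv_eq_zero hρ ε
  obtain ⟨hone, hmin⟩ : 1 < gammaStar ρ ε
      ∧ IsMinOn (fun g => psi g ρ ε) (Set.Ioi 1) (gammaStar ρ ε) :=
    Classical.epsilon_spec (p := fun γ => γ ∈ Set.Ioi (1 : ℝ)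
      ∧ IsMinOn (fun g => psi g ρ ε) (Set.Ioi 1) γ)
      ⟨γ, hγ, (isMinOn_psi_iff hγ ρ ε).2 (isMinOn_logPsi hρ.le hγ hzero)⟩
  exact ⟨hone, (((isMinOn_psi_iff hone ρ ε).1 hmin).isLocalMin
    (Ioi_mem_nhds hone)).hasDerivAt_eq_zero (hasDerivAt_logPsi hone ρ ε)⟩

theorem lt_gammaStar_iff (hρ : 0 < ρ) (ε : ℝ) (hγ : 1 < γ) :
    γ < gammaStar ρ ε ↔ logPsiDeriv γ ρ ε < 0 := by
  obtain ⟨hone, hzero⟩ := gammaStar_spec hρ ε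
  rw [← (strictMonoOn_logPsiDeriv hρ.le ε).lt_iff_lt hγ hone, hzero]

theorem gammaStar_lt_iff (hρ : 0 < ρ) (ε : ℝ) (hγ : 1 < γ) :
    gammaStar ρ ε < γ ↔ 0 < logPsiDeriv γ ρ ε := by
  obtain ⟨hone, hzero⟩ := gammaStar_spec hρ ε
  rw [← (strictMonoOn_logPsiDeriv hρ.le ε).lt_iff_lt hone hγ, hzero]

theorem continuousAt_gammaStar (hρ : 0 < ρ) (ε : ℝ) :
    ContinuousAt (fun p : ℝ × ℝ => gammaStar p.1 p.2) (ρ, ε) := by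
  have hpos : ∀ᶠ p : ℝ × ℝ in 𝓝 (ρ, ε), 0 < p.1 := continuousAt_fst.eventually (lt_mem_nhds hρ)
  have hcont : ∀ a, ContinuousAt (fun p : ℝ × ℝ => logPsiDeriv a p.1 p.2) (ρ, ε) := fun a => by
    unfold logPsiDeriv
    fun_prop
  refine tendsto_order.2 ⟨fun a ha => ?_, fun a ha => ?_⟩
  · rcases le_or_gt a 1 with ha1 | ha1
    · filter_upwards [hpos] with p hp using ha1.trans_lt (gammaStar_spec hp p.2).1
    · filter_upwards [hpos, (hcont a).eventually (gt_mem_nhds ((lt_gammaStar_iff hρ ε ha1).1 ha))]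
        with p hp hpa using (lt_gammaStar_iff hp p.2 ha1).2 hpa
  · have ha1 : 1 < a := (gammaStar_spec hρ ε).1.trans ha
    filter_upwards [hpos, (hcont a).eventually (lt_mem_nhds ((gammaStar_lt_iff hρ ε ha1).1 ha))]
      with p hp hpa using (gammaStar_lt_iff hp p.2 ha1).2 hpa

theorem continuousAt_psi (hγ : 1 < γ) (ρ ε : ℝ) :
    ContinuousAt (fun q : ℝ × ℝ × ℝ => psi q.1 q.2.1 q.2.2) (γ, ρ, ε) := by
  have hγ0 : γ ≠ 0 := by linarith
  unfold psi
  refine ContinuousAt.div (ContinuousAt.mul (by fun_prop) ?_) (by fun_prop) (sub_pos.2 hγ).ne'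
  exact (continuousAt_const.sub (continuousAt_fst.inv₀ hγ0)).rpow continuousAt_fst
    (.inl (one_sub_inv_pos hγ).ne')

end OptimalOrder

/-! ### The error bound -/

theorem rho_eq_div (n₀ n : ℕ) (kk : ℕ → ℕ) (σ : ℝ) (t : ℕ) :
    rho n₀ n kk (fun _ => σ) t = rho n₀ n kk (fun _ => 1) t / σ ^ 2 := by
  rw [rho, rho, Finset.sum_div]
  refine Finset.sum_congr rfl fun τ _ => ?_
  rw [div_div]
  congr 1
  ring

theorem rho_antitone (n₀ n : ℕ) (kk : ℕ → ℕ) (σ : ℕ → ℝ) : Antitone (rho n₀ n kk σ) := by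
  intro s t hst
  refine Finset.sum_le_sum fun τ _ => ?_
  gcongr ?_ / _
  gcongr
  split_ifs <;> first | omega | norm_num

theorem rho_nonneg (n₀ n : ℕ) (kk : ℕ → ℕ) (σ : ℕ → ℝ) (t : ℕ) : 0 ≤ rho n₀ n kk σ t :=
  Finset.sum_nonneg fun τ _ => by positivity

theorem rho_eq_rho_one {n₀ t : ℕ} (ht1 : 1 ≤ t) (ht : t ≤ n₀) (n : ℕ) (kk : ℕ → ℕ) (σ : ℕ → ℝ) :
    rho n₀ n kk σ t = rho n₀ n kk σ 1 := by
  refine Finset.sum_congr rfl fun τ hτ => ?_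
  have hτ₀ := (Finset.mem_Icc.1 hτ).1
  rw [if_pos (by omega), if_pos (by omega)]

theorem rho_one_pos {n₀ n : ℕ} (hn₀ : 1 ≤ n₀) {kk : ℕ → ℕ} (hk : 1 ≤ totalQueries n₀ n kk)
    {σ : ℝ} (hσ : σ ≠ 0) : 0 < rho n₀ n kk (fun _ => σ) 1 := by
  obtain ⟨τ, hτ, hkτ⟩ : ∃ τ ∈ Finset.Icc n₀ n, kk τ ≠ 0 :=
    Finset.exists_ne_zero_of_sum_ne_zero (Nat.one_le_iff_ne_zero.1 hk)
  have hτ1 : 1 ≤ τ := hn₀.trans (Finset.mem_Icc.1 hτ).1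
  refine Finset.sum_pos' (fun τ _ => by positivity) ⟨τ, hτ, ?_⟩
  rw [if_pos hτ1]
  have : 0 < kk τ := Nat.pos_of_ne_zero hkτ
  positivity

theorem delta_eq {n : ℕ} (hn : 1 ≤ n) (n₀ : ℕ) (kk : ℕ → ℕ) (σ : ℕ → ℝ) (ε : ℝ) (t : ℕ) :
    delta n₀ n kk σ ε t = psi (gammaStar (rho n₀ n kk σ 1) ε) (rho n₀ n kk σ t) ε := by
  have hmax : IsGreatest (rho n₀ n kk σ '' Set.Icc 1 n) (rho n₀ n kk σ 1) :=
    (rho_antitone n₀ n kk σ).map_isLeast (isLeast_Icc hn)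
  rw [delta, hmax.csSup_eq]

section ErrBound

variable {n₀ n : ℕ} {kk : ℕ → ℕ}

theorem delta_pos (hn₀ : 1 ≤ n₀) (hn : n₀ ≤ n) (hk : 1 ≤ totalQueries n₀ n kk) {σ : ℝ}
    (hσ : σ ≠ 0) (ε : ℝ) (t : ℕ) : 0 < delta n₀ n kk (fun _ => σ) ε t := by
  rw [delta_eq (hn₀.trans hn)]
  exact psi_pos (gammaStar_spec (rho_one_pos hn₀ hk hσ) ε).1 _ _

theorem mul_delta_one_le_sum_delta (hn₀ : 1 ≤ n₀) (hn : n₀ ≤ n)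
    (hk : 1 ≤ totalQueries n₀ n kk) {σ : ℝ} (hσ : σ ≠ 0) (ε : ℝ) :
    n₀ * delta n₀ n kk (fun _ => σ) ε 1 ≤ ∑ τ ∈ Finset.Icc 1 n, delta n₀ n kk (fun _ => σ) ε τ := by
  have hconst : ∀ τ ∈ Finset.Icc 1 n₀,
      delta n₀ n kk (fun _ => σ) ε τ = delta n₀ n kk (fun _ => σ) ε 1 := fun τ hτ => by
    rw [delta, delta, rho_eq_rho_one (Finset.mem_Icc.1 hτ).1 (Finset.mem_Icc.1 hτ).2]
  calc n₀ * delta n₀ n kk (fun _ => σ) ε 1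
      = ∑ τ ∈ Finset.Icc 1 n₀, delta n₀ n kk (fun _ => σ) ε τ := by
        rw [Finset.sum_congr rfl hconst, Finset.sum_const, Nat.card_Icc, nsmul_eq_mul,
          add_tsub_cancel_right]
    _ ≤ ∑ τ ∈ Finset.Icc 1 n, delta n₀ n kk (fun _ => σ) ε τ :=
        Finset.sum_le_sum_of_subset_of_nonneg (Finset.Icc_subset_Icc_right hn)
          fun τ _ _ => (delta_pos hn₀ hn hk hσ ε τ).le

theorem one_sub_exp_le_delta_one (hn₀ : 1 ≤ n₀) (hn : n₀ ≤ n) (hk : 1 ≤ totalQueries n₀ n kk)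
    {σ : ℝ} (hσ : σ ≠ 0) (ε : ℝ) :
    1 - Real.exp (ε - rho n₀ n kk (fun _ => σ) 1) ≤ delta n₀ n kk (fun _ => σ) ε 1 := by
  rw [delta_eq (hn₀.trans hn)]
  exact one_sub_exp_le_psi (gammaStar_spec (rho_one_pos hn₀ hk hσ) ε).1 (rho_nonneg ..) ε

theorem continuousAt_delta (hn₀ : 1 ≤ n₀) (hn : n₀ ≤ n) (hk : 1 ≤ totalQueries n₀ n kk) (t : ℕ)
    {p : ℝ × ℝ × ℝ} (hp : p.1 ≠ 0) :
    ContinuousAt (fun p : ℝ × ℝ × ℝ => delta n₀ n kk (fun _ => p.1) p.2.2 t) p := by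
  have hrho : ∀ t, ContinuousAt (fun p : ℝ × ℝ × ℝ => rho n₀ n kk (fun _ => p.1) t) p := fun t => by
    have hdiv : ContinuousAt (fun p : ℝ × ℝ × ℝ => rho n₀ n kk (fun _ => 1) t / p.1 ^ 2) p :=
      continuousAt_const.div (by fun_prop) (pow_ne_zero 2 hp)
    exact hdiv.congr (.of_forall fun p => (rho_eq_div n₀ n kk p.1 t).symm)
  have hε : ContinuousAt (fun p : ℝ × ℝ × ℝ => p.2.2) p := continuousAt_snd.snd
  have hρ := rho_one_pos hn₀ hk hp
  have hγ : ContinuousAt (fun p : ℝ × ℝ × ℝ => gammaStar (rho n₀ n kk (fun _ => p.1) 1) p.2.2) p :=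
    ContinuousAt.comp (x := p) (g := fun p : ℝ × ℝ => gammaStar p.1 p.2)
      (f := fun p : ℝ × ℝ × ℝ => (rho n₀ n kk (fun _ => p.1) 1, p.2.2))
      (continuousAt_gammaStar hρ p.2.2) ((hrho 1).prodMk hε)
  simp only [delta_eq (hn₀.trans hn)]
  exact ContinuousAt.comp (x := p) (g := fun q : ℝ × ℝ × ℝ => psi q.1 q.2.1 q.2.2)
    (f := fun p : ℝ × ℝ × ℝ => (gammaStar (rho n₀ n kk (fun _ => p.1) 1) p.2.2,
      rho n₀ n kk (fun _ => p.1) t, p.2.2))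
    (continuousAt_psi (gammaStar_spec hρ p.2.2).1 _ _) (hγ.prodMk ((hrho t).prodMk hε))

theorem continuousOn_errBound (hn₀ : 1 ≤ n₀) (hn : n₀ ≤ n) (hk : 1 ≤ totalQueries n₀ n kk)
    (β' : ℝ) : ContinuousOn (errBound n₀ n kk β') Theta := by
  intro p hp
  have hsum : ContinuousAt (fun p : ℝ × ℝ × ℝ =>
      ∑ τ ∈ Finset.Icc 1 n, delta n₀ n kk (fun _ => p.1) p.2.2 τ) p :=
    tendsto_finsetSum _ fun τ _ => continuousAt_delta hn₀ hn hk τ hp.1.ne'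
  have hβk := div_totalQueries_mem_Ioo hk hp.2.1
  have herfc : ContinuousAt (fun p : ℝ × ℝ × ℝ => erfcInv (p.2.1 / totalQueries n₀ n kk)) p :=
    ContinuousAt.comp (f := fun p : ℝ × ℝ × ℝ => p.2.1 / totalQueries n₀ n kk)
      (continuousAt_erfcInv ⟨hβk.1, hβk.2.trans one_lt_two⟩)
      (ContinuousAt.div_const (by fun_prop) _)
  unfold errBound
  exact ContinuousAt.continuousWithinAt (by fun_prop)

theorem box_subset_Theta {σ₀ σ₁ β₀ β₁ ε₁ : ℝ} (hσ : 0 < σ₀) (hβ₀ : 0 < β₀) (hβ₁ : β₁ < 1) :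
    Set.Icc σ₀ σ₁ ×ˢ Set.Icc β₀ β₁ ×ˢ Set.Icc 0 ε₁ ⊆ Theta :=
  fun _ hp => ⟨hσ.trans_le hp.1.1, ⟨hβ₀.trans_le hp.2.1.1, hp.2.1.2.trans_lt hβ₁⟩, hp.2.2.1⟩

theorem bounds_of_errBound_lt_one (hn₀ : 1 ≤ n₀) (hn : n₀ ≤ n) (hk : 1 ≤ totalQueries n₀ n kk)
    {β' σ β ε : ℝ} (hβ' : 0 < β') (hp : (σ, β, ε) ∈ Theta)
    (hlt : errBound n₀ n kk β' (σ, β, ε) < 1) :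
    √2 * σ * erfcInv (β / totalQueries n₀ n kk) < 1 ∧ β < β' ∧ ε < 1 ∧
      2 * ∑ τ ∈ Finset.Icc 1 n, delta n₀ n kk (fun _ => σ) ε τ < n₀ * β' := by
  obtain ⟨hσ, hβ, hε⟩ : 0 < σ ∧ (0 < β ∧ β < 1) ∧ 0 ≤ ε := hp
  have : (0 : ℝ) < n₀ := Nat.cast_pos.2 hn₀
  have hsum : 0 ≤ ∑ τ ∈ Finset.Icc 1 n, delta n₀ n kk (fun _ => σ) ε τ :=
    Finset.sum_nonneg fun τ _ => (delta_pos hn₀ hn hk hσ.ne' ε τ).le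
  have hu := erfcInv_pos (div_totalQueries_mem_Ioo hk hβ)
  simp only [errBound] at hlt
  generalize ∑ τ ∈ Finset.Icc 1 n, delta n₀ n kk (fun _ => σ) ε τ = D at *
  have hnoise : 0 < √2 * σ * erfcInv (β / totalQueries n₀ n kk) := by positivity
  have hexp : ε + 1 ≤ Real.exp ε := Real.add_one_le_exp ε
  have hβdiv : 0 < β / β' := div_pos hβ.1 hβ'
  have hDdiv : 0 ≤ 2 * D / (n₀ * β') := by positivity
  have hsqrt : 0 ≤ 2 / β' * √(2 * β * D / n₀) := by positivity
  refine ⟨by linarith, (div_lt_one hβ').1 (by linarith), by linarith,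
    (div_lt_one (by positivity)).1 (by linarith)⟩

theorem rho_one_lt_two_of_sum_delta_lt (hn₀ : 1 ≤ n₀) (hn : n₀ ≤ n)
    (hk : 1 ≤ totalQueries n₀ n kk) {σ ε : ℝ} (hσ : σ ≠ 0) (hε : ε ≤ 1)
    (hsum : 2 * ∑ τ ∈ Finset.Icc 1 n, delta n₀ n kk (fun _ => σ) ε τ < n₀) :
    rho n₀ n kk (fun _ => σ) 1 < 2 := by
  have hdelta : delta n₀ n kk (fun _ => σ) ε 1 < 1 / 2 := by
    have hmul := mul_delta_one_le_sum_delta hn₀ hn hk hσ ε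
    refine lt_of_mul_lt_mul_left (a := (n₀ : ℝ)) ?_ (Nat.cast_nonneg _)
    linarith
  by_contra! hρ
  have hexp : Real.exp (ε - rho n₀ n kk (fun _ => σ) 1) < 1 / 2 :=
    calc Real.exp (ε - rho n₀ n kk (fun _ => σ) 1) ≤ Real.exp (-1) :=
          Real.exp_le_exp.2 (by linarith)
      _ < 1 / 2 := Real.exp_neg_one_lt_half
  linarith [one_sub_exp_le_delta_one hn₀ hn hk hσ ε]

/- The bound on `δ` keeps `σ` away from `0`; the noise term `√2 σ erfc⁻¹(β / k) < 1` then keeps `β`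
away from `0`, and `σ` bounded because `β < β'`. -/
theorem exists_isCompact_of_errBound_lt_one (hn₀ : 1 ≤ n₀) (hn : n₀ ≤ n)
    (hk : 1 ≤ totalQueries n₀ n kk) {β' : ℝ} (hβ' : β' ∈ Set.Ioo (0 : ℝ) 1) :
    ∃ K ⊆ Theta, IsCompact K ∧ ∀ p ∈ Theta, errBound n₀ n kk β' p < 1 → p ∈ K := by
  set σ₀ := √(rho n₀ n kk (fun _ => 1) 1 / 2) with hσ₀_def
  have hσ₀ : 0 < σ₀ := Real.sqrt_pos.2 (half_pos (rho_one_pos hn₀ hk one_ne_zero))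
  refine ⟨Set.Icc σ₀ (1 / (√2 * erfcInv β')) ×ˢ Set.Icc (erfc (1 / (√2 * σ₀))) β' ×ˢ Set.Icc 0 1,
    box_subset_Theta hσ₀ (erfc_pos _) hβ'.2,
    isCompact_Icc.prod (isCompact_Icc.prod isCompact_Icc), ?_⟩
  rintro ⟨σ, β, ε⟩ hp hlt
  obtain ⟨hnoise, hββ', hε1, hsum⟩ := bounds_of_errBound_lt_one hn₀ hn hk hβ'.1 hp hlt
  obtain ⟨hσ, hβ, hε⟩ : 0 < σ ∧ (0 < β ∧ β < 1) ∧ 0 ≤ ε := hp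
  obtain ⟨hβk0, hβk1⟩ := div_totalQueries_mem_Ioo hk hβ
  have hβk : β / totalQueries n₀ n kk ≤ β := div_le_self hβ.1.le (by exact_mod_cast hk)
  have hu' : 0 < erfcInv β' := erfcInv_pos hβ'
  have hu : erfcInv β' ≤ erfcInv (β / totalQueries n₀ n kk) :=
    strictAntiOn_erfcInv.antitoneOn ⟨hβk0, by linarith⟩ ⟨hβ'.1, by linarith [hβ'.2]⟩
      (hβk.trans hββ'.le)
  have hσ₀σ : σ₀ ≤ σ := by
    have hρ := rho_one_lt_two_of_sum_delta_lt hn₀ hn hk hσ.ne' hε1.le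
      (hsum.trans_le (mul_le_of_le_one_right (Nat.cast_nonneg _) hβ'.2.le))
    rw [rho_eq_div, div_lt_iff₀ (by positivity)] at hρ
    rw [hσ₀_def, Real.sqrt_le_left hσ.le]
    linarith
  have hσ₁ : σ ≤ 1 / (√2 * erfcInv β') := by
    rw [le_div_iff₀ (by positivity)]
    calc σ * (√2 * erfcInv β') = √2 * σ * erfcInv β' := by ring
      _ ≤ √2 * σ * erfcInv (β / totalQueries n₀ n kk) := by gcongr
      _ ≤ 1 := hnoise.le
  have hβ₀ : erfc (1 / (√2 * σ₀)) ≤ β / totalQueries n₀ n kk := by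
    rw [← erfc_erfcInv ⟨hβk0, hβk1.trans one_lt_two⟩]
    refine strictAnti_erfc.antitone ((le_div_iff₀ (by positivity)).2 ?_)
    calc erfcInv (β / totalQueries n₀ n kk) * (√2 * σ₀)
        = √2 * σ₀ * erfcInv (β / totalQueries n₀ n kk) := by ring
      _ ≤ √2 * σ * erfcInv (β / totalQueries n₀ n kk) := by gcongr; exact hu'.le.trans hu
      _ ≤ 1 := hnoise.le
  exact ⟨⟨hσ₀σ, hσ₁⟩, ⟨hβ₀.trans hβk, hββ'.le⟩, hε, hε1.le⟩

theorem exists_errBound_eq_sInf (hn₀ : 1 ≤ n₀) (hn : n₀ ≤ n) (hk : 1 ≤ totalQueries n₀ n kk)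
    {β' : ℝ} (hβ' : β' ∈ Set.Ioo (0 : ℝ) 1) (h : sInf (errBound n₀ n kk β' '' Theta) < 1) :
    ∃ p ∈ Theta, errBound n₀ n kk β' p = sInf (errBound n₀ n kk β' '' Theta) := by
  obtain ⟨K, hKT, hK, hmem⟩ := exists_isCompact_of_errBound_lt_one hn₀ hn hk hβ'
  have hne : (errBound n₀ n kk β' '' Theta).Nonempty :=
    ⟨_, (1, 1 / 2, 0), ⟨one_pos, ⟨by norm_num, by norm_num⟩, le_rfl⟩, rfl⟩
  obtain ⟨_, ⟨p₀, hp₀, rfl⟩, hlt⟩ := exists_lt_of_csInf_lt hne h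
  obtain ⟨p, hpK, hp⟩ := hK.exists_isMinOn ⟨p₀, hmem p₀ hp₀ hlt⟩
    ((continuousOn_errBound hn₀ hn hk β').mono hKT)
  suffices hmin : IsLeast (errBound n₀ n kk β' '' Theta) (errBound n₀ n kk β' p) from
    ⟨p, hKT hpK, hmin.csInf_eq.symm⟩
  refine ⟨⟨p, hKT hpK, rfl⟩, ?_⟩
  rintro _ ⟨q, hq, rfl⟩
  rcases lt_or_ge (errBound n₀ n kk β' q) 1 with hq1 | hq1
  · exact isMinOn_iff.1 hp q (hmem q hq hq1)
  · exact (isMinOn_iff.1 hp p₀ (hmem p₀ hp₀ hlt)).trans (hlt.le.trans hq1)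

theorem distAccurate_errBound {X : Type*} [Finite X] [MeasurableSpace X]
    [MeasurableSingletonClass X] (hn₀ : 1 ≤ n₀) (hn : n₀ ≤ n) (hk : 1 ≤ totalQueries n₀ n kk)
    {β' : ℝ} (hβ' : 0 < β') {σ β ε : ℝ} (hp : (σ, β, ε) ∈ Theta) :
    DistAccurate (clippedGaussian X fun _ => σ) n₀ n kk
      (fun _ => errBound n₀ n kk β' (σ, β, ε)) β' := by
  obtain ⟨hσ, hβ, hε⟩ : 0 < σ ∧ (0 < β ∧ β < 1) ∧ 0 ≤ ε := hp
  have hγ := (gammaStar_spec (rho_one_pos hn₀ hk hσ.ne') ε).1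
  refine (distAccurate_clippedGaussian hn₀ hn hk (fun _ _ => hσ) hβ hε hγ hβ').mono fun _ => ?_
  have hD : 0 ≤ ∑ τ ∈ Finset.Icc 1 n, delta n₀ n kk (fun _ => σ) ε τ :=
    Finset.sum_nonneg fun τ _ => (delta_pos hn₀ hn hk hσ.ne' ε τ).le
  simp only [errBound, ← delta_eq (hn₀.trans hn)]
  generalize ∑ τ ∈ Finset.Icc 1 n, delta n₀ n kk (fun _ => σ) ε τ = D at *
  have hsplit : (β + D / n₀) / β' = β / β' + D / (n₀ * β') := by rw [add_div, div_div]
  have hdouble : 2 * D / (n₀ * β') = D / (n₀ * β') + D / (n₀ * β') := by ring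
  have hDdiv : 0 ≤ D / (n₀ * β') := by positivity
  have hsqrt : 0 ≤ 2 / β' * √(2 * β * D / n₀) := by
    positivity
  linarith

end ErrBound

end GrowingADA

end

theorem mainTheorem6 {X : Type*} [Finite X] [MeasurableSpace X] [MeasurableSingletonClass X]
    (n₀ n : ℕ) (hn₀ : 1 ≤ n₀) (hn : n₀ ≤ n)
    (kk : ℕ → ℕ) (hk : 1 ≤ GrowingADA.totalQueries n₀ n kk)
    (β' : ℝ) (hβ' : β' ∈ Set.Ioo (0 : ℝ) 1) (α' : ℝ)
    (hα' : α' = sInf (GrowingADA.errBound n₀ n kk β' '' GrowingADA.Theta)) :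
    -- every choice of the parameters gives a valid bound for the mechanism with that `σ`
    (∀ σ β ε : ℝ, (σ, β, ε) ∈ GrowingADA.Theta →
      GrowingADA.DistAccurate (GrowingADA.clippedGaussian X fun _ => σ) n₀ n kk
        (fun _ => GrowingADA.errBound n₀ n kk β' (σ, β, ε)) β') ∧
    -- the optimal bound is attained unless it is at least the trivial bound `1`
    (α' < 1 → ∃ p ∈ GrowingADA.Theta, GrowingADA.errBound n₀ n kk β' p = α') ∧
    -- a suitable noise level achieves the optimal bound
    (∃ σ : ℝ, 0 < σ ∧
      GrowingADA.DistAccurate (GrowingADA.clippedGaussian X fun _ => σ) n₀ n kk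
        (fun _ => α') β') := by
  subst hα'
  refine ⟨fun σ β ε h => GrowingADA.distAccurate_errBound hn₀ hn hk hβ'.1 h,
    GrowingADA.exists_errBound_eq_sInf hn₀ hn hk hβ', ?_⟩
  rcases lt_or_ge (sInf (GrowingADA.errBound n₀ n kk β' '' GrowingADA.Theta)) 1 with hlt | hge
  · obtain ⟨⟨σ, β, ε⟩, hp, heq⟩ := GrowingADA.exists_errBound_eq_sInf hn₀ hn hk hβ' hlt
    rw [← heq]
    exact ⟨σ, hp.1, GrowingADA.distAccurate_errBound hn₀ hn hk hβ'.1 hp⟩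
  · exact ⟨1, one_pos,
      GrowingADA.distAccurate_clippedGaussian_of_one_le _ n₀ n kk (fun _ => hge) hβ'.1.le⟩
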